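/- **Setting.** Let $\mathcal X$ be a measurable space of instances, $\mathcal Y$ a finite set of labels, and $\Phi:\mathcal X\times\mathcal Y\to\mathbb R^m$, $m\ge 1$, a measurable feature mapping with $\|\Phi(x,y)\|_\infty\le M$ for all $(x,y)$, such that the set $\{(\Phi(x,y))_{y\in\mathcal Y}:x\in\mathcal X\}\subset(\mathbb R^m)^{\mathcal Y}$ is compact (e.g. $\mathcal X$ finite, or $\mathcal X$ compact and $\Phi$ continuous in $x$). Vector operations and inequalities are componentwise. For a set $\mathcal U$ of probability distributions on $\mathcal X\times\mathcal Y$ let $R(\mathcal U)=\min_h\max_{q\in\mathcal U}\ell(h,q)$, where $h$ ranges over the (possibly randomized) classification rules and $\ell(h,q)=\mathbb P_{(x,y)\sim q}\{h(x)\ne y\}$ is the expected 0-1 loss (minimum and maximum are understood as infimum and supremum). **Tasks.** Let $p_1,\dots,p_k$ be random probability distributions on $\mathcal X\times\mathcal Y$ whose changes $p_2-p_1,\dots,p_k-p_{k-1}$ are independent and zero-mean (evolving task assumption). Given $p_1,\dots,p_k$, the samples $(x_{j,i},y_{j,i})$, $1\le j\le k$, $1\le i\le n_j$ ($n_j\ge1$),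 are independent, with $(x_{j,i},y_{j,i})\sim p_j$. Put $\tau_j^\infty=\mathbb E_{p_j}\Phi(x,y)$, $w_j=\tau_j^\infty-\tau_{j-1}^\infty$, $\tau_j=\frac1{n_j}\sum_{i=1}^{n_j}\Phi(x_{j,i},y_{j,i})$. Let $\sigma_j,d_j\in\mathbb R^m$ be deterministic vectors with $0<\sigma_j^{(i)}\le M$ and $d_j^{(i)}\ge0$, and put $s_j=\sigma_j^2/n_j$. Forward learning uses $\tau_1^\rightharpoonup=\tau_1$, $s_1^\rightharpoonup=s_1$ and, for $2\le j\le k$, $$\tau_j^\rightharpoonup=\tau_j+\frac{s_j}{s_{j-1}^\rightharpoonup+s_j+d_j^2}\left(\tau_{j-1}^\rightharpoonup-\tau_j\right),\qquad s_j^\rightharpoonup=\left(\frac1{s_j}+\frac1{s_{j-1}^\rightharpoonup+d_j^2}\right)^{-1}.$$ Let $\mathcal U_j^\rightharpoonup=\{q:|\mathbb E_q\Phi-\tau_j^\rightharpoonup|\preceq\lambda_j^\rightharpoonup\}$ with $\lambda_j^\rightharpoonup=\sqrt{s_j^\rightharpoonup}$, let $R_j^\infty=R(\{q:\mathbb E_q\Phi=\tau_j^\infty\})$,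 and let $\mu_j^\infty$ denote a solution of $$\min_{\mu\in\mathbb R^m}\;1-(\tau_j^\infty)^{\mathsf T}\mu+\max_{x\in\mathcal X,\,\emptyset\ne\mathcal C\subseteq\mathcal Y}\frac{\sum_{y\in\mathcal C}\Phi(x,y)^{\mathsf T}\mu-1}{|\mathcal C|}.$$ **Theorem.** Let $\kappa\ge0$ be such that, almost surely, for $1\le j\le k$ each component $\Phi^{(i)}$ is sub-Gaussian under $p_j$ with parameter $\kappa\sigma_j^{(i)}$, and for $2\le j\le k$ each $w_j^{(i)}$ is sub-Gaussian with parameter $\kappa d_j^{(i)}$. (A random variable $W$ is sub-Gaussian with parameter $s$ if $\mathbb E\,e^{t(W-\mathbb E W)}\le e^{s^2t^2/2}$ for all $t\in\mathbb R$.) Then there are deterministic effective sample sizes $n_1^\rightharpoonup,\dots,n_k^\rightharpoonup$ with $n_1^\rightharpoonup=n_1$ and $$n_j^\rightharpoonup\ge n_j+n_{j-1}^\rightharpoonup\frac{\|\sigma_j^2\|_\infty}{\|\sigma_j^2\|_\infty+n_{j-1}^\rightharpoonup\|d_j^2\|_\infty}\qquad(2\le j\le k)$$ such that for every $\delta\in(0,1)$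 and every $j\in\{1,\dots,k\}$, with probability at least $1-\delta$, for every solution $\mu_j^\infty$, $$R(\mathcal U_j^\rightharpoonup)\le R_j^\infty+\frac{M(\kappa+1)\sqrt{2\log(2m/\delta)}}{\sqrt{n_j^\rightharpoonup}}\,\|\mu_j^\infty\|_1 .$$ -/

import Mathlib

open MeasureTheory ProbabilityTheory

noncomputable section

namespace Evolving

/-! Tasks are numbered `0, 1, …, k - 1`. Instances live in `X`, labels in `Y`, and the feature
mapping is `Φ : X × Y → (Fin m → ℝ)`. All vector operations and inequalities are componentwise. -/

section Minimax

variable {X Y : Type*} [MeasurableSpace X] [MeasurableSpace Y] {m : ℕ}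

/-- The mean vector `𝔼_q Φ(x, y)`. -/
def meanVec (Φ : X × Y → Fin m → ℝ) (q : Measure (X × Y)) : Fin m → ℝ :=
  fun i => ∫ z, Φ z i ∂q

/-- The uncertainty set of the distributions `q` with `|𝔼_q Φ - τ| ≼ lam`. -/
def uncertaintySet (Φ : X × Y → Fin m → ℝ) (τ lam : Fin m → ℝ) :
    Set (ProbabilityMeasure (X × Y)) :=
  {q | ∀ i, |meanVec Φ (q : Measure (X × Y)) i - τ i| ≤ lam i}

/-- The set of the distributions `q` with `𝔼_q Φ = τ`. -/
def exactSet (Φ : X × Y → Fin m → ℝ) (τ : Fin m → ℝ) : Set (ProbabilityMeasure (X × Y)) :=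
  {q | meanVec Φ (q : Measure (X × Y)) = τ}

variable (X Y) in
/-- (Possibly randomized) classification rules: an instance is mapped to a distribution on labels,
measurably in the instance. -/
def Rule : Type _ := {h : Kernel X Y // IsMarkovKernel h}

/-- Expected 0-1 loss: the probability under `q` that the label assigned by `h` is wrong. -/
def loss (h : Rule X Y) (q : Measure (X × Y)) : ℝ :=
  ∫ z, (h.1 z.1).real {y | y ≠ z.2} ∂q

/-- The minimax risk `R(U)`: the least, over rules, of the worst-case expected loss over `U`. -/
def minimaxRisk (U : Set (ProbabilityMeasure (X × Y))) : ℝ :=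
  ⨅ h : Rule X Y, ⨆ q : U, loss h (q.1 : Measure (X × Y))

/-- The objective of the convex problem that determines the parameter of minimax risk classifiers:
`1 - τᵀμ + max_{x, C} (∑_{y ∈ C} Φ(x, y)ᵀμ - 1) / |C| + lamᵀ|μ|`, with `C` over the nonempty sets
of labels. -/
def mrcObjective (Φ : X × Y → Fin m → ℝ) (τ lam μ : Fin m → ℝ) : ℝ :=
  1 - ∑ i, τ i * μ i
    + (⨆ xC : X × {C : Finset Y // C.Nonempty},
        ((∑ y ∈ xC.2.1, ∑ i, Φ (xC.1, y) i * μ i) - 1) / (xC.2.1.card : ℝ))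
    + ∑ i, lam i * |μ i|

/-- `μ` is a solution of the convex problem with mean vector `τ` and confidence vector `lam`. -/
def IsMRCParameter (Φ : X × Y → Fin m → ℝ) (τ lam μ : Fin m → ℝ) : Prop :=
  ∀ ν : Fin m → ℝ, mrcObjective Φ τ lam μ ≤ mrcObjective Φ τ lam ν

end Minimax

/-- The real random variable `W` is sub-Gaussian with parameter `s`:
`𝔼 exp (t (W - 𝔼 W)) ≤ exp (s² t² / 2)` for all `t`. -/
def IsSubG {Ω : Type*} [MeasurableSpace Ω] (W : Ω → ℝ) (s : ℝ) (P : Measure Ω) : Prop :=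
  HasSubgaussianMGF (fun ω => W ω - ∫ ω', W ω' ∂P) ⟨s ^ 2, sq_nonneg s⟩ P

section Tasks

variable {Ω X Y : Type*} [MeasurableSpace Ω] [MeasurableSpace X] [MeasurableSpace Y] {m : ℕ}

/-- The change from the `j`-th to the next (random) task distribution, as a random signed measure,
that is, as the family of its values on measurable sets (with the product σ-algebra). -/
def change (p : ℕ → Kernel Ω (X × Y)) (j : ℕ) (ω : Ω) : {A : Set (X × Y) // MeasurableSet A} → ℝ :=
  fun A => (p (j + 1) ω).real A.1 - (p j ω).real A.1

/-- Evolving task assumption for the random distributions `p 0, …, p (k - 1)`: the changes between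
consecutive distributions are independent and zero-mean. -/
structure EvolvingTasks (P : Measure Ω) (k : ℕ) (p : ℕ → Kernel Ω (X × Y)) : Prop where
  indep : iIndepFun (fun (j : {j : ℕ // j + 1 < k}) => change p j.1) P
  zero_mean : ∀ j, j + 1 < k → ∀ A, ∫ ω, change p j ω A ∂P = 0

/-- Given the task distributions `p 0, …, p (k - 1)`, the samples `Z j i`, `j < k`, `i < n j`, are
independent and `Z j i` has distribution `p j`. -/
structure AreSamples (P : Measure Ω) (k : ℕ) (n : ℕ → ℕ) (p : ℕ → Kernel Ω (X × Y))
    (Z : ℕ → ℕ → Ω → X × Y) : Prop where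
  measurable : ∀ j < k, ∀ i < n j, Measurable (Z j i)
  law : ∀ S : Set (Fin k → Measure (X × Y)), MeasurableSet S →
    ∀ A : ℕ → ℕ → Set (X × Y), (∀ j i, MeasurableSet (A j i)) →
    P {ω | (fun j : Fin k => p j ω) ∈ S ∧ ∀ j < k, ∀ i < n j, Z j i ω ∈ A j i} =
      ∫⁻ ω in {ω | (fun j : Fin k => p j ω) ∈ S},
        ∏ j ∈ Finset.range k, ∏ i ∈ Finset.range (n j), p j ω (A j i) ∂P

/-- The sample average `τ_j` of the features in the `j`-th sample set. -/
def sampleMean (Φ : X × Y → Fin m → ℝ) (n : ℕ → ℕ) (Z : ℕ → ℕ → Ω → X × Y) (j : ℕ) (ω : Ω) :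
    Fin m → ℝ :=
  fun i => (1 / (n j : ℝ)) * ∑ l ∈ Finset.range (n j), Φ (Z j l ω) i

/-- The single-task vector `s_j = σ_j² / n_j`. -/
def singleMSE (n : ℕ → ℕ) (σ : ℕ → Fin m → ℝ) (j : ℕ) : Fin m → ℝ :=
  fun i => σ j i ^ 2 / (n j : ℝ)

/-- The forward vectors `s_j^⇀`. -/
def fwdMSE (n : ℕ → ℕ) (σ d : ℕ → Fin m → ℝ) : ℕ → Fin m → ℝ
  | 0 => singleMSE n σ 0
  | j + 1 => fun i =>
      (1 / singleMSE n σ (j + 1) i + 1 / (fwdMSE n σ d j i + d (j + 1) i ^ 2))⁻¹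

/-- The forward mean vectors `τ_j^⇀`. -/
def fwdMean (Φ : X × Y → Fin m → ℝ) (n : ℕ → ℕ) (Z : ℕ → ℕ → Ω → X × Y)
    (σ d : ℕ → Fin m → ℝ) : ℕ → Ω → Fin m → ℝ
  | 0 => sampleMean Φ n Z 0
  | j + 1 => fun ω i =>
      sampleMean Φ n Z (j + 1) ω i
        + singleMSE n σ (j + 1) i
            / (fwdMSE n σ d j i + singleMSE n σ (j + 1) i + d (j + 1) i ^ 2)
          * (fwdMean Φ n Z σ d j ω i - sampleMean Φ n Z (j + 1) ω i)

/-- The forward uncertainty set `U_j^⇀`, with confidence vector `√(s_j^⇀)`. -/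
def fwdSet (Φ : X × Y → Fin m → ℝ) (n : ℕ → ℕ) (Z : ℕ → ℕ → Ω → X × Y)
    (σ d : ℕ → Fin m → ℝ) (j : ℕ) (ω : Ω) : Set (ProbabilityMeasure (X × Y)) :=
  uncertaintySet Φ (fwdMean Φ n Z σ d j ω) (fun i => √(fwdMSE n σ d j i))

end Tasks

end Evolving

end

/-!
The bound combines a deterministic comparison of minimax risks with a concentration inequality for
the forward estimate.

**Comparison.** Let `V(τ, lam)` be the optimal value of the convex problem. Every parameter `μ`
defines a classification rule (`exists_rule_error_le`) whose error against any distribution of an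
uncertainty set is at most the objective at `μ` (`minimaxRisk_uncertaintySet_le`). Conversely, for
exact mean vectors, `V(τ, 0)` is a lower bound for the risk
(`mrcObjective_le_minimaxRisk_exactSet`): at a minimizer, `τ` is a subgradient of the maximum over
pairs `(x, C)`, hence a convex combination of feature averages over active pairs, because the set of
all pieces is compact. The corresponding mixture of uniform distributions on `{x} × C` has mean
vector `τ`, and no rule has loss below `V(τ, 0)` against it. Evaluating the upper bound of
the forward set at a solution for `τ_j^∞` therefore costs at most
`∑ i, (|τ_j^⇀ - τ_j^∞| + √s_j^⇀) i * |μ i|`.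

**Concentration.** The error `τ_j^⇀ - τ_j^∞` is a linear combination of the errors of the sample
means, which are conditionally independent given the tasks, and of the changes `w_l`, which are
independent (`exists_fwdMean_sub_eq`). Integrating out the samples first and the tasks afterwards
(`AreSamples.lintegral_exp_error_le`) shows that its components are sub-Gaussian, and the weights
of the forward step are such that the variance proxy is exactly `κ² s_j^⇀`
(`fwdMSE_succ_eq`). A union bound over the `2 m` tails gives
`|τ_j^⇀ - τ_j^∞| ≼ κ √(s_j^⇀) √(2 log (2 m / δ))` with probability at least `1 - δ`.

**Sample sizes.** Defining the effective sample sizes by equality in their recursion, one gets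
`s_j^⇀ ≼ M² / n_j^⇀` by induction (`fwdMSE_mul_effSize_le`), and `√(2 log (2 m / δ)) ≥ 1` absorbs the
confidence vector into the factor `κ + 1`.
-/

noncomputable section

namespace Evolving


/-! ### Duality of the minimax problem -/

/-- In finite dimension the convex hull of a compact set is compact: by Carathéodory's theorem it is
the continuous image of a simplex times a power of the set. -/
theorem isCompact_convexHull {E : Type*} [NormedAddCommGroup E] [NormedSpace ℝ E]
    [FiniteDimensional ℝ E] {K : Set E} (hK : IsCompact K) : IsCompact (convexHull ℝ K) := by
  obtain rfl | ⟨z₀, hz₀⟩ := K.eq_empty_or_nonempty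
  · simp
  set D := Module.finrank ℝ E + 1
  have hc : IsCompact ((fun q : (Fin D → ℝ) × (Fin D → E) => ∑ i, q.1 i • q.2 i) ''
      (stdSimplex ℝ (Fin D) ×ˢ Set.univ.pi fun _ => K)) :=
    ((isCompact_stdSimplex ℝ (Fin D)).prod (isCompact_univ_pi fun _ => hK)).image (by fun_prop)
  convert hc using 1
  apply Set.Subset.antisymm
  · intro x hx
    obtain ⟨ι, _, z, w, hz, hind, hw, hw1, rfl⟩ := eq_pos_convex_span_of_mem_convexHull hx
    have hcard : Fintype.card ι ≤ Fintype.card (Fin D) := by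
      rw [Fintype.card_fin]
      exact hind.card_le_finrank_succ.trans
        (Nat.succ_le_succ (Submodule.finrank_le _))
    obtain ⟨e⟩ := Function.Embedding.nonempty_of_card_le hcard
    have hout : ∀ i ∉ Set.range e, Function.extend e w 0 i = 0 := fun i hi => by
      rw [Function.extend_apply' _ _ _ (by simpa using hi)]; rfl
    refine ⟨(Function.extend e w 0, Function.extend e z fun _ => z₀), ⟨⟨?_, ?_⟩, ?_⟩, ?_⟩
    · intro i
      by_cases hi : i ∈ Set.range e
      · obtain ⟨a, rfl⟩ := hi
        simpa [e.injective.extend_apply] using (hw a).le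
      · exact (hout i hi).ge
    · rw [← hw1]
      exact (Fintype.sum_of_injective e e.injective _ _ hout
        fun a => (e.injective.extend_apply _ _ _).symm).symm
    · intro i _
      by_cases hi : i ∈ Set.range e
      · obtain ⟨a, rfl⟩ := hi
        simpa [e.injective.extend_apply] using hz ⟨a, rfl⟩
      · simpa [Function.extend_apply' _ _ _ (show ¬∃ a, e a = i by simpa using hi)] using hz₀
    · refine (Fintype.sum_of_injective e e.injective _ _ ?_ ?_).symm
      · intro i hi
        simp [hout i hi]
      · intro a
        simp [e.injective.extend_apply]
  · rintro _ ⟨⟨w, z⟩, ⟨⟨hw, hw1⟩, hz⟩, rfl⟩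
    exact mem_convexHull_of_exists_fintype w z hw hw1 (fun i => hz i trivial) rfl

section Minimax

variable {X Y : Type*} {m : ℕ}

/-- The affine function `μ ↦ aᵀμ - b` whose maximum over instances `x` and nonempty label sets `C`
occurs in `mrcObjective`, recorded as the pair `(a, b)`: the mean of the features over `C`, and
`1 / |C|`. -/
def labelPiece (Φ : X × Y → Fin m → ℝ) (xC : X × {C : Finset Y // C.Nonempty}) :
    (Fin m → ℝ) × ℝ :=
  (fun i => (∑ y ∈ xC.2.1, Φ (xC.1, y) i) / (xC.2.1.card : ℝ), 1 / (xC.2.1.card : ℝ))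

/-- The maximum over instances and nonempty label sets in `mrcObjective`. -/
def labelMax (Φ : X × Y → Fin m → ℝ) (μ : Fin m → ℝ) : ℝ :=
  ⨆ xC : X × {C : Finset Y // C.Nonempty},
    ((∑ y ∈ xC.2.1, ∑ i, Φ (xC.1, y) i * μ i) - 1) / (xC.2.1.card : ℝ)

theorem mrcObjective_zero (Φ : X × Y → Fin m → ℝ) (τ μ : Fin m → ℝ) :
    mrcObjective Φ τ 0 μ = 1 - ∑ i, τ i * μ i + labelMax Φ μ := by
  simp [mrcObjective, labelMax]

theorem labelPiece_eval (Φ : X × Y → Fin m → ℝ) (xC : X × {C : Finset Y // C.Nonempty})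
    (μ : Fin m → ℝ) :
    ((∑ y ∈ xC.2.1, ∑ i, Φ (xC.1, y) i * μ i) - 1) / (xC.2.1.card : ℝ) =
      ∑ i, (labelPiece Φ xC).1 i * μ i - (labelPiece Φ xC).2 := by
  rw [sub_div, Finset.sum_comm, Finset.sum_div]
  simp only [labelPiece]
  congr 1
  refine Finset.sum_congr rfl fun i _ => ?_
  rw [← Finset.sum_mul, div_mul_eq_mul_div]

theorem bddAbove_labelPiece {Φ : X × Y → Fin m → ℝ} {M : ℝ} (hM : ∀ z i, |Φ z i| ≤ M)
    (μ : Fin m → ℝ) :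
    BddAbove (Set.range fun xC : X × {C : Finset Y // C.Nonempty} =>
      ((∑ y ∈ xC.2.1, ∑ i, Φ (xC.1, y) i * μ i) - 1) / (xC.2.1.card : ℝ)) := by
  refine ⟨∑ i, M * |μ i|, ?_⟩
  rintro _ ⟨⟨x, C, hC⟩, rfl⟩
  have hc : (0 : ℝ) < C.card := by exact_mod_cast hC.card_pos
  simp only
  rw [div_le_iff₀ hc]
  have : ∀ y ∈ C, ∑ i, Φ (x, y) i * μ i ≤ ∑ i, M * |μ i| := fun y _ =>
    Finset.sum_le_sum fun i _ => (le_abs_self _).trans <| by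
      rw [abs_mul]; exact mul_le_mul_of_nonneg_right (hM _ _) (abs_nonneg _)
  have := Finset.sum_le_card_nsmul C _ _ this
  rw [nsmul_eq_mul] at this
  linarith

theorem labelPiece_le_labelMax {Φ : X × Y → Fin m → ℝ} {M : ℝ} (hM : ∀ z i, |Φ z i| ≤ M)
    (μ : Fin m → ℝ) (xC : X × {C : Finset Y // C.Nonempty}) :
    ∑ i, (labelPiece Φ xC).1 i * μ i - (labelPiece Φ xC).2 ≤ labelMax Φ μ := by
  rw [← labelPiece_eval]
  exact le_ciSup (bddAbove_labelPiece hM μ) xC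

theorem isCompact_range_labelPiece [Finite Y] {Φ : X × Y → Fin m → ℝ}
    (hcompact : IsCompact (Set.range fun (x : X) (y : Y) => Φ (x, y))) :
    IsCompact (Set.range (labelPiece Φ)) := by
  have : Set.range (labelPiece Φ) = ⋃ C : {C : Finset Y // C.Nonempty},
      (fun g : Y → Fin m → ℝ => ((fun i => (∑ y ∈ C.1, g y i) / (C.1.card : ℝ),
        1 / (C.1.card : ℝ)) : (Fin m → ℝ) × ℝ)) ''
        (Set.range fun (x : X) (y : Y) => Φ (x, y)) := by
    ext z
    simp [labelPiece]
    constructor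
    · rintro ⟨x, C, hC, rfl⟩
      exact ⟨C, hC, x, rfl⟩
    · rintro ⟨C, hC, x, rfl⟩
      exact ⟨x, C, hC, rfl⟩
  rw [this]
  exact isCompact_iUnion fun C => hcompact.image (by fun_prop)

/-- Optimality of `μ` puts `τ` into the subdifferential of the maximum, that is, among the convex
combinations of the pieces. If no such combination had offset at most `τᵀμ - labelMax Φ μ`, a
separating functional `(a, -b)` would give the better parameter `(μ + a) / (1 + b)`. -/
theorem exists_mem_convexHull_labelPiece [Finite Y] [Nonempty X] [Nonempty Y]
    {Φ : X × Y → Fin m → ℝ} {M : ℝ}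
    (hM : ∀ z i, |Φ z i| ≤ M)
    (hcompact : IsCompact (Set.range fun (x : X) (y : Y) => Φ (x, y)))
    {τ μ : Fin m → ℝ} (hμ : ∀ ν : Fin m → ℝ,
      labelMax Φ μ - ∑ i, τ i * μ i ≤ labelMax Φ ν - ∑ i, τ i * ν i) :
    ∃ c : ℝ, (τ, c) ∈ convexHull ℝ (Set.range (labelPiece Φ)) ∧
      c ≤ ∑ i, τ i * μ i - labelMax Φ μ := by
  by_contra! hcon
  set c₀ := ∑ i, τ i * μ i - labelMax Φ μ
  have hray : IsClosed ({τ} ×ˢ Set.Iic c₀ : Set ((Fin m → ℝ) × ℝ)) :=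
    isClosed_singleton.prod isClosed_Iic
  have hdisj : Disjoint (convexHull ℝ (Set.range (labelPiece Φ)))
      ({τ} ×ˢ Set.Iic c₀ : Set ((Fin m → ℝ) × ℝ)) := by
    rw [Set.disjoint_left]
    rintro ⟨a, c⟩ h1 ⟨h2, h3⟩
    obtain rfl : a = τ := h2
    exact absurd (hcon c h1) (not_lt.mpr h3)
  obtain ⟨f, u, v, hfu, huv, hfv⟩ := geometric_hahn_banach_compact_closed (convex_convexHull ℝ _)
    (isCompact_convexHull (isCompact_range_labelPiece hcompact))
    ((convex_singleton τ).prod (convex_Iic c₀)) hray hdisj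
  set a : Fin m → ℝ := fun i => f (Pi.single i 1, 0)
  set b : ℝ := - f (0, 1)
  have hf : ∀ (g : Fin m → ℝ) (c : ℝ), f (g, c) = ∑ i, g i * a i - b * c := by
    intro g c
    have h1 : (g, c) = ∑ i, g i • ((Pi.single i 1, 0) : (Fin m → ℝ) × ℝ) + c • (0, 1) := by
      refine Prod.ext ?_ ?_
      · simp only [Prod.fst_add, Prod.fst_sum, Prod.smul_fst, smul_zero, add_zero]
        exact pi_eq_sum_univ' g
      · simp [Prod.snd_sum]
    rw [h1, map_add, map_sum]
    simp only [map_smul, smul_eq_mul, a, b]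
    ring
  have hb : 0 ≤ b := by
    by_contra! hb
    -- moving down the ray, `f` would reach `v`
    have hge : v < f (τ, c₀) := hfv _ ⟨rfl, le_refl c₀⟩
    have hle : c₀ - (f (τ, c₀) - v) / (-b) ≤ c₀ :=
      sub_le_self _ (div_nonneg (by linarith) (by linarith))
    have := hfv (τ, c₀ - (f (τ, c₀) - v) / (-b)) ⟨rfl, hle⟩
    rw [hf, hf] at this
    have h2 : b * (c₀ - (∑ i, τ i * a i - b * c₀ - v) / (-b))
        = b * c₀ + (∑ i, τ i * a i - b * c₀ - v) := by
      have := hb.ne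
      field_simp
      ring
    rw [h2] at this
    linarith
  have hb1 : 0 < 1 + b := by linarith
  have hτ : u < ∑ i, τ i * a i - b * c₀ := by
    rw [← hf]; exact huv.trans (hfv _ ⟨rfl, le_refl c₀⟩)
  have hmax : labelMax Φ (fun i => (μ i + a i) / (1 + b)) ≤ (labelMax Φ μ + u) / (1 + b) := by
    have : Nonempty {C : Finset Y // C.Nonempty} := ⟨⟨{Classical.arbitrary Y}, by simp⟩⟩
    refine ciSup_le fun xC => ?_
    rw [labelPiece_eval, le_div_iff₀ hb1]
    have h1 := labelPiece_le_labelMax hM μ xC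
    have h2 := hfu _ (subset_convexHull ℝ _ ⟨xC, rfl⟩)
    rw [← Prod.mk.eta (p := labelPiece Φ xC), hf] at h2
    have h3 : (∑ i, (labelPiece Φ xC).1 i * ((μ i + a i) / (1 + b))) * (1 + b)
        = ∑ i, (labelPiece Φ xC).1 i * μ i + ∑ i, (labelPiece Φ xC).1 i * a i := by
      rw [Finset.sum_mul, ← Finset.sum_add_distrib]
      exact Finset.sum_congr rfl fun i _ => by field_simp
    nlinarith
  have h3 : (∑ i, τ i * ((μ i + a i) / (1 + b))) * (1 + b)
        = ∑ i, τ i * μ i + ∑ i, τ i * a i := by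
    rw [Finset.sum_mul, ← Finset.sum_add_distrib]
    exact Finset.sum_congr rfl fun i _ => by field_simp
  have h4 := hμ fun i => (μ i + a i) / (1 + b)
  rw [le_div_iff₀ hb1] at hmax
  have h5 : -c₀ * (1 + b) ≤ (labelMax Φ (fun i => (μ i + a i) / (1 + b))
      - ∑ i, τ i * ((μ i + a i) / (1 + b))) * (1 + b) :=
    mul_le_mul_of_nonneg_right (by simpa [c₀] using h4) hb1.le
  have h6 : c₀ = ∑ i, τ i * μ i - labelMax Φ μ := rfl
  nlinarith

end Minimax


/-! ### Bounds on the minimax risk -/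

section Minimax

variable {X Y : Type*} [MeasurableSpace X] [MeasurableSpace Y] {m : ℕ}

theorem measurable_loss_integrand [Finite Y] [MeasurableSingletonClass Y] (h : Rule X Y) :
    Measurable fun z : X × Y => (h.1 z.1).real {y | y ≠ z.2} :=
  measurable_from_prod_countable_left fun y =>
    (Kernel.measurable_coe h.1 (Set.toFinite {y' | y' ≠ y}).measurableSet).ennreal_toReal

theorem loss_integrand_le_one (h : Rule X Y) (x : X) (s : Set Y) : (h.1 x).real s ≤ 1 := by
  have := h.2
  exact measureReal_le_one

theorem loss_nonneg (h : Rule X Y) (q : Measure (X × Y)) : 0 ≤ loss h q :=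
  integral_nonneg fun _ => measureReal_nonneg

theorem integrable_loss_integrand [Finite Y] [MeasurableSingletonClass Y] (h : Rule X Y)
    (q : Measure (X × Y)) [IsFiniteMeasure q] :
    Integrable (fun z : X × Y => (h.1 z.1).real {y | y ≠ z.2}) q :=
  .of_bound (measurable_loss_integrand h).aestronglyMeasurable 1 <| ae_of_all _ fun z => by
    rw [Real.norm_of_nonneg measureReal_nonneg]; exact loss_integrand_le_one h _ _

theorem loss_le_one [Finite Y] [MeasurableSingletonClass Y] (h : Rule X Y)
    (q : Measure (X × Y)) [IsProbabilityMeasure q] : loss h q ≤ 1 := by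
  refine (integral_mono (integrable_loss_integrand h q) (integrable_const 1)
    fun z => loss_integrand_le_one h _ _).trans ?_
  simp

theorem minimaxRisk_nonneg (U : Set (ProbabilityMeasure (X × Y))) : 0 ≤ minimaxRisk U :=
  Real.iInf_nonneg fun h => Real.iSup_nonneg fun _ => loss_nonneg h _

theorem minimaxRisk_empty : minimaxRisk (∅ : Set (ProbabilityMeasure (X × Y))) = 0 := by
  simp [minimaxRisk]

/-- The finitely supported measure `∑ i, w i • Unif({x i} × C i)`. -/
def uniformMixture {ι : Type*} [Fintype ι] (w : ι → ℝ)
    (xC : ι → X × {C : Finset Y // C.Nonempty}) : Measure (X × Y) :=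
  ∑ i, ∑ y ∈ (xC i).2.1,
    ENNReal.ofReal (w i / ((xC i).2.1.card : ℝ)) • Measure.dirac ((xC i).1, y)

theorem integral_uniformMixture {ι : Type*} [Fintype ι] {w : ι → ℝ} (hw : ∀ i, 0 ≤ w i)
    (xC : ι → X × {C : Finset Y // C.Nonempty}) {f : X × Y → ℝ} (hf : Measurable f) {B : ℝ}
    (hB : ∀ z, |f z| ≤ B) :
    ∫ z, f z ∂uniformMixture w xC =
      ∑ i, w i * ((∑ y ∈ (xC i).2.1, f ((xC i).1, y)) / ((xC i).2.1.card : ℝ)) := by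
  have hint : ∀ (c : ℝ) (z : X × Y), Integrable f (ENNReal.ofReal c • Measure.dirac z) :=
    fun c z => (Integrable.of_bound hf.aestronglyMeasurable B (ae_of_all _ hB)).smul_measure
      ENNReal.ofReal_ne_top
  unfold uniformMixture
  rw [integral_finsetSum_measure fun i _ => integrable_finsetSum_measure.2 fun y _ => hint _ _]
  refine Finset.sum_congr rfl fun i _ => ?_
  rw [integral_finsetSum_measure fun y _ => hint _ _, mul_div_assoc', Finset.mul_sum,
    Finset.sum_div]
  refine Finset.sum_congr rfl fun y _ => ?_
  rw [integral_smul_measure, integral_dirac' _ _ hf.stronglyMeasurable,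
    ENNReal.toReal_ofReal (div_nonneg (hw i) (Nat.cast_nonneg _)), smul_eq_mul]
  ring

theorem isProbabilityMeasure_uniformMixture {ι : Type*} [Fintype ι] {w : ι → ℝ}
    (hw : ∀ i, 0 ≤ w i) (hw1 : ∑ i, w i = 1) (xC : ι → X × {C : Finset Y // C.Nonempty}) :
    IsProbabilityMeasure (uniformMixture w xC) := by
  constructor
  simp only [uniformMixture, Measure.finsetSum_apply, Measure.smul_apply, measure_univ,
    smul_eq_mul, mul_one, Finset.sum_const, nsmul_eq_mul]
  rw [← ENNReal.ofReal_one, ← hw1, ENNReal.ofReal_sum_of_nonneg fun i _ => hw i]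
  refine Finset.sum_congr rfl fun i _ => ?_
  have hc : ((xC i).2.1.card : ℝ) ≠ 0 := by exact_mod_cast (xC i).2.2.card_pos.ne'
  rw [← ENNReal.ofReal_natCast, ← ENNReal.ofReal_mul (Nat.cast_nonneg _), mul_div_cancel₀ _ hc]

/-- A rule gives the labels in `C` total probability at most `1`, which bounds from below its loss
under the uniform distribution on `{x} × C`. -/
theorem card_sub_one_le_sum_loss [Finite Y] [MeasurableSingletonClass Y] (h : Rule X Y) (x : X)
    (C : Finset Y) : (C.card : ℝ) - 1 ≤ ∑ y ∈ C, (h.1 x).real {y' | y' ≠ y} := by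
  have := h.2
  have h1 : ∀ y ∈ C, (h.1 x).real {y' | y' ≠ y} = 1 - (h.1 x).real {y} := fun y _ =>
    probReal_compl_eq_one_sub (measurableSet_singleton y)
  rw [Finset.sum_congr rfl h1, Finset.sum_sub_distrib, sum_measureReal_singleton]
  have : (h.1 x).real (C : Set Y) ≤ 1 := measureReal_le_one
  simp only [Finset.sum_const, nsmul_eq_mul, mul_one]
  linarith

/-- Strong duality (lower bound): the optimal value of the convex problem is attained as the least
loss against a single distribution with mean vector `τ`, a mixture of uniform distributions on the
label sets that are active at the optimum. -/
theorem mrcObjective_le_minimaxRisk_exactSet [Finite Y] [MeasurableSingletonClass Y]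
    [Nonempty X] [Nonempty Y] {Φ : X × Y → Fin m → ℝ} (hΦ : Measurable Φ)
    {M : ℝ} (hM : ∀ z i, |Φ z i| ≤ M)
    (hcompact : IsCompact (Set.range fun (x : X) (y : Y) => Φ (x, y)))
    {τ μ : Fin m → ℝ} (hμ : IsMRCParameter Φ τ 0 μ) :
    mrcObjective Φ τ 0 μ ≤ minimaxRisk (exactSet Φ τ) := by
  obtain ⟨c, hc, hcle⟩ := exists_mem_convexHull_labelPiece hM hcompact (τ := τ) (μ := μ)
    fun ν => by
      have := hμ ν
      rw [mrcObjective_zero, mrcObjective_zero] at this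
      linarith
  obtain ⟨ι, _, w, z, hw, hw1, hz, hsum⟩ := mem_convexHull_iff_exists_fintype.1 hc
  choose xC hxC using hz
  obtain rfl : labelPiece Φ ∘ xC = z := funext hxC
  have hprob := isProbabilityMeasure_uniformMixture hw hw1 xC
  have hq : (⟨uniformMixture w xC, hprob⟩ : ProbabilityMeasure (X × Y)) ∈ exactSet Φ τ := by
    ext i
    have hτ := congrFun (congrArg Prod.fst hsum) i
    simp only [Prod.fst_sum, Finset.sum_apply, Prod.smul_fst, Pi.smul_apply, smul_eq_mul,
      Function.comp, labelPiece] at hτ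
    rw [← hτ]
    exact integral_uniformMixture hw xC (measurable_pi_iff.1 hΦ i) fun z => hM z i
  have hoff : ∑ i, w i * (1 / ((xC i).2.1.card : ℝ)) = c := by
    have := congrArg Prod.snd hsum
    simpa only [Prod.snd_sum, Prod.smul_snd, smul_eq_mul, Function.comp, labelPiece] using this
  have : Nonempty (Rule X Y) :=
    ⟨⟨Kernel.const X (Measure.dirac (Classical.arbitrary Y)), inferInstance⟩⟩
  refine le_ciInf fun h => ?_
  have hbdd : BddAbove (Set.range fun q : exactSet Φ τ => loss h (q.1 : Measure (X × Y))) :=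
    ⟨1, by rintro _ ⟨q, rfl⟩; exact loss_le_one h _⟩
  refine le_trans ?_ (le_ciSup hbdd ⟨_, hq⟩)
  change _ ≤ ∫ z, _ ∂uniformMixture w xC
  rw [integral_uniformMixture hw xC (measurable_loss_integrand h) (B := 1) fun z => by
    rw [abs_of_nonneg measureReal_nonneg]; exact loss_integrand_le_one h _ _]
  calc mrcObjective Φ τ 0 μ ≤ 1 - c := by rw [mrcObjective_zero]; linarith
    _ = ∑ i, w i * ((((xC i).2.1.card : ℝ) - 1) / ((xC i).2.1.card : ℝ)) := by
      rw [← hoff, ← hw1, ← Finset.sum_sub_distrib]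
      refine Finset.sum_congr rfl fun i _ => ?_
      have hc : ((xC i).2.1.card : ℝ) ≠ 0 := by exact_mod_cast (xC i).2.2.card_pos.ne'
      field_simp
    _ ≤ _ := by
      refine Finset.sum_le_sum fun i _ => mul_le_mul_of_nonneg_left ?_ (hw i)
      exact div_le_div_of_nonneg_right (card_sub_one_le_sum_loss h _ _) (Nat.cast_nonneg _)

/-- The classification rule defined by a parameter `μ`: its error probability on `(x, y)` is at most
`1 - Φ(x, y)ᵀμ + labelMax Φ μ`. The label `y` gets the positive part of `Φ(x, y)ᵀμ - labelMax Φ μ`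
as probability, and the mass that is left over is spread uniformly. -/
theorem exists_rule_error_le [Finite Y] [MeasurableSingletonClass Y] [Nonempty Y]
    {Φ : X × Y → Fin m → ℝ} (hΦ : Measurable Φ) {M : ℝ} (hM : ∀ z i, |Φ z i| ≤ M)
    (μ : Fin m → ℝ) :
    ∃ h : Rule X Y, ∀ z : X × Y,
      (h.1 z.1).real {y | y ≠ z.2} ≤ 1 - ∑ i, Φ z i * μ i + labelMax Φ μ := by
  classical
  have := Fintype.ofFinite Y
  set a : X → Y → ℝ := fun x y => max (∑ i, Φ (x, y) i * μ i - labelMax Φ μ) 0 with ha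
  have ha0 : ∀ x y, 0 ≤ a x y := fun x y => le_max_right _ _
  have ha1 : ∀ x, ∑ y, a x y ≤ 1 := by
    intro x
    set C := Finset.univ.filter fun y => 0 < ∑ i, Φ (x, y) i * μ i - labelMax Φ μ with hC
    have hsum : ∑ y, a x y = ∑ y ∈ C, (∑ i, Φ (x, y) i * μ i - labelMax Φ μ) := by
      rw [hC, Finset.sum_filter]
      refine Finset.sum_congr rfl fun y _ => ?_
      split_ifs with hy
      · exact max_eq_left hy.le
      · exact max_eq_right (not_lt.1 hy)
    rw [hsum]
    obtain hCe | hCne := C.eq_empty_or_nonempty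
    · rw [hCe]; simp
    have hc : (0 : ℝ) < C.card := by exact_mod_cast hCne.card_pos
    have := labelPiece_le_labelMax hM μ (x, ⟨C, hCne⟩)
    rw [← labelPiece_eval, div_le_iff₀ hc] at this
    simp only [Finset.sum_sub_distrib, Finset.sum_const, nsmul_eq_mul] at this ⊢
    linarith
  have ham : ∀ y, Measurable fun x => a x y := by
    intro y
    have h1 : ∀ i, Measurable fun x => Φ (x, y) i := fun i =>
      (measurable_pi_iff.1 hΦ i).comp (measurable_id.prodMk measurable_const)
    exact ((Finset.measurable_sum _ fun i _ => (h1 i).mul_const _).sub_const _).max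
      measurable_const
  set b : X → Y → ℝ := fun x y => a x y + (1 - ∑ y', a x y') / Fintype.card Y with hb
  have hab : ∀ x y, a x y ≤ b x y := fun x y =>
    le_add_of_nonneg_right (div_nonneg (by linarith [ha1 x]) (Nat.cast_nonneg _))
  have hb1 : ∀ x, ∑ y, b x y = 1 := by
    intro x
    have hY : (Fintype.card Y : ℝ) ≠ 0 := by exact_mod_cast Fintype.card_ne_zero
    simp only [hb, Finset.sum_add_distrib, Finset.sum_const, nsmul_eq_mul, Finset.card_univ]
    field_simp
    ring
  have hbm : ∀ y, Measurable fun x => b x y := fun y =>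
    (ham y).add ((measurable_const.sub (Finset.measurable_sum _ fun y _ => ham y)).div_const _)
  have hkm : Measurable fun x => ∑ y, ENNReal.ofReal (b x y) • Measure.dirac y := by
    refine Measure.measurable_of_measurable_coe _ fun s _ => ?_
    simp only [Measure.finsetSum_apply, Measure.smul_apply, smul_eq_mul]
    exact Finset.measurable_sum _ fun y _ => (hbm y).ennreal_ofReal.mul_const _
  have hmk : IsMarkovKernel (⟨_, hkm⟩ : Kernel X Y) := by
    refine ⟨fun x => ⟨?_⟩⟩
    change (∑ y, ENNReal.ofReal (b x y) • Measure.dirac y) Set.univ = 1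
    simp only [Measure.finsetSum_apply, Measure.smul_apply, measure_univ, smul_eq_mul, mul_one]
    rw [← ENNReal.ofReal_sum_of_nonneg fun y _ => (ha0 x y).trans (hab x y), hb1,
      ENNReal.ofReal_one]
  refine ⟨⟨⟨_, hkm⟩, hmk⟩, fun ⟨x, y⟩ => ?_⟩
  set κ : Kernel X Y := ⟨_, hkm⟩
  have h1 : (κ x).real {y' | y' ≠ y} = 1 - (κ x).real {y} :=
    probReal_compl_eq_one_sub (measurableSet_singleton y)
  have h2 : a x y ≤ (κ x).real {y} := by
    refine (hab x y).trans ?_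
    rw [Measure.real, ← ENNReal.ofReal_le_iff_le_toReal (measure_ne_top _ _)]
    change _ ≤ (∑ y, ENNReal.ofReal (b x y) • Measure.dirac y) {y}
    simp only [Measure.finsetSum_apply, Measure.smul_apply, smul_eq_mul]
    refine le_trans ?_ (Finset.single_le_sum (fun _ _ => zero_le) (Finset.mem_univ y))
    simp
  change (κ x).real {y' | y' ≠ y} ≤ _
  rw [h1]
  have h3 : ∑ i, Φ (x, y) i * μ i - labelMax Φ μ ≤ a x y := le_max_left _ _
  linarith

/-- Weak duality (upper bound) for an uncertainty set that is not empty. -/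
theorem minimaxRisk_uncertaintySet_le [Finite Y] [MeasurableSingletonClass Y] [Nonempty Y]
    {Φ : X × Y → Fin m → ℝ} (hΦ : Measurable Φ) {M : ℝ} (hM : ∀ z i, |Φ z i| ≤ M)
    {τ lam : Fin m → ℝ} (hne : (uncertaintySet Φ τ lam).Nonempty) (μ : Fin m → ℝ) :
    minimaxRisk (uncertaintySet Φ τ lam) ≤
      1 - ∑ i, τ i * μ i + labelMax Φ μ + ∑ i, lam i * |μ i| := by
  obtain ⟨h, hh⟩ := exists_rule_error_le hΦ hM μ
  have hbdd : BddBelow (Set.range fun h : Rule X Y =>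
      ⨆ q : uncertaintySet Φ τ lam, loss h (q.1 : Measure (X × Y))) :=
    ⟨0, by rintro _ ⟨h, rfl⟩; exact Real.iSup_nonneg fun _ => loss_nonneg h _⟩
  refine (ciInf_le hbdd h).trans ?_
  have : Nonempty (uncertaintySet Φ τ lam) := hne.to_subtype
  refine ciSup_le fun ⟨q, hq⟩ => ?_
  have hint : ∀ i, Integrable (fun z => Φ z i) (q : Measure (X × Y)) := fun i =>
    .of_bound (measurable_pi_iff.1 hΦ i).aestronglyMeasurable M (ae_of_all _ fun z => hM z i)
  have hints : Integrable (fun z => ∑ i, Φ z i * μ i) (q : Measure (X × Y)) :=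
    integrable_finsetSum _ fun i _ => (hint i).mul_const _
  have hints' : Integrable (fun z => 1 - ∑ i, Φ z i * μ i) (q : Measure (X × Y)) :=
    (integrable_const _).sub hints
  calc loss h (q : Measure (X × Y))
      ≤ ∫ z, (1 - ∑ i, Φ z i * μ i + labelMax Φ μ) ∂(q : Measure (X × Y)) :=
        integral_mono (integrable_loss_integrand h _)
          (hints'.add (integrable_const _)) hh
    _ = 1 - ∑ i, meanVec Φ (q : Measure (X × Y)) i * μ i + labelMax Φ μ := by
        rw [integral_add hints' (integrable_const _),
          integral_sub (integrable_const _) hints,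
          integral_finsetSum _ fun i _ => (hint i).mul_const _]
        simp [integral_mul_const, meanVec]
    _ ≤ _ := by
        have : ∑ i, τ i * μ i - ∑ i, meanVec Φ (q : Measure (X × Y)) i * μ i
            ≤ ∑ i, lam i * |μ i| := by
          rw [← Finset.sum_sub_distrib]
          refine Finset.sum_le_sum fun i _ => ?_
          rw [← sub_mul]
          refine (le_abs_self _).trans ?_
          rw [abs_mul, abs_sub_comm]
          exact mul_le_mul_of_nonneg_right (hq i) (abs_nonneg _)
        linarith

/-- Excess of the minimax risk over that of the exact mean vector `τ`, when the uncertainty set is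
built around an estimate `τ'`. An empty uncertainty set has risk `0` by convention, which is
harmless because losses are nonnegative. -/
theorem minimaxRisk_uncertaintySet_le_exactSet [Finite Y] [MeasurableSingletonClass Y]
    [Nonempty X] [Nonempty Y] {Φ : X × Y → Fin m → ℝ} (hΦ : Measurable Φ)
    {M : ℝ} (hM : ∀ z i, |Φ z i| ≤ M)
    (hcompact : IsCompact (Set.range fun (x : X) (y : Y) => Φ (x, y)))
    {τ τ' lam μ : Fin m → ℝ} (hμ : IsMRCParameter Φ τ 0 μ) {B : ℝ} (hB0 : 0 ≤ B)
    (hB : ∀ i, |τ' i - τ i| + lam i ≤ B) :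
    minimaxRisk (uncertaintySet Φ τ' lam) ≤
      minimaxRisk (exactSet Φ τ) + B * ∑ i, |μ i| := by
  obtain he | hne := (uncertaintySet Φ τ' lam).eq_empty_or_nonempty
  · rw [he, minimaxRisk_empty]
    have := minimaxRisk_nonneg (exactSet Φ τ)
    positivity
  have h1 := minimaxRisk_uncertaintySet_le hΦ hM hne μ
  have h2 := mrcObjective_le_minimaxRisk_exactSet hΦ hM hcompact hμ
  rw [mrcObjective_zero] at h2
  have h3 : ∑ i, τ i * μ i - ∑ i, τ' i * μ i + ∑ i, lam i * |μ i| ≤ B * ∑ i, |μ i| := by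
    rw [← Finset.sum_sub_distrib, ← Finset.sum_add_distrib, Finset.mul_sum]
    refine Finset.sum_le_sum fun i _ => ?_
    have h4 : τ i * μ i - τ' i * μ i ≤ |τ' i - τ i| * |μ i| := by
      rw [← sub_mul, abs_sub_comm, ← abs_mul]; exact le_abs_self _
    have h5 := mul_le_mul_of_nonneg_right (hB i) (abs_nonneg (μ i))
    linarith
  linarith

end Minimax


/-! ### Forward recursions and effective sample sizes -/

section Recursion

variable {m : ℕ} {n : ℕ → ℕ} {σ d : ℕ → Fin m → ℝ} {k : ℕ}

theorem singleMSE_pos (hn : ∀ j < k, 1 ≤ n j) (hσ : ∀ j < k, ∀ i, 0 < σ j i) {j : ℕ} (hj : j < k)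
    (i : Fin m) : 0 < singleMSE n σ j i :=
  div_pos (pow_pos (hσ j hj i) 2) (by exact_mod_cast hn j hj)

theorem fwdMSE_pos (hn : ∀ j < k, 1 ≤ n j) (hσ : ∀ j < k, ∀ i, 0 < σ j i) {j : ℕ} (hj : j < k)
    (i : Fin m) : 0 < fwdMSE n σ d j i := by
  induction j with
  | zero => exact singleMSE_pos hn hσ hj i
  | succ j ih =>
    have h1 := singleMSE_pos hn hσ hj i
    have h2 := ih (by omega)
    simp only [fwdMSE]
    positivity

/-- The gain `s_{j+1} / (s_j^⇀ + s_{j+1} + d_{j+1}^2)` of the forward step. -/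
def gain (n : ℕ → ℕ) (σ d : ℕ → Fin m → ℝ) (j : ℕ) (i : Fin m) : ℝ :=
  singleMSE n σ (j + 1) i / (fwdMSE n σ d j i + singleMSE n σ (j + 1) i + d (j + 1) i ^ 2)

/-- The forward vector is the mean squared error of the forward estimate: the gain weights the
independent errors of the two estimates that a forward step combines. -/
theorem fwdMSE_succ_eq (hn : ∀ j < k, 1 ≤ n j) (hσ : ∀ j < k, ∀ i, 0 < σ j i) {j : ℕ}
    (hj : j + 1 < k) (i : Fin m) :
    fwdMSE n σ d (j + 1) i = (1 - gain n σ d j i) ^ 2 * singleMSE n σ (j + 1) i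
      + gain n σ d j i ^ 2 * (fwdMSE n σ d j i + d (j + 1) i ^ 2) := by
  have h1 := singleMSE_pos hn hσ hj i
  have h2 : 0 < fwdMSE n σ d j i := fwdMSE_pos hn hσ (by omega) i
  have h3 := sq_nonneg (d (j + 1) i)
  simp only [fwdMSE, gain]
  set s := singleMSE n σ (j + 1) i
  set f := fwdMSE n σ d j i
  set e := d (j + 1) i ^ 2
  have h4 : f + e ≠ 0 := by positivity
  have h5 : f + s + e ≠ 0 := by positivity
  have h6 : s + (f + e) ≠ 0 := by positivity
  field_simp
  ring

/-- Effective sample sizes, defined by equality in the recursive lower bound. -/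
def effSize (n : ℕ → ℕ) (σ d : ℕ → Fin m → ℝ) : ℕ → ℝ
  | 0 => n 0
  | j + 1 => n (j + 1) + effSize n σ d j *
      (‖fun i => σ (j + 1) i ^ 2‖
        / (‖fun i => σ (j + 1) i ^ 2‖ + effSize n σ d j * ‖fun i => d (j + 1) i ^ 2‖))

theorem effSize_pos (hn : ∀ j < k, 1 ≤ n j) {j : ℕ} (hj : j < k) : 0 < effSize n σ d j := by
  induction j with
  | zero => exact Nat.cast_pos.2 (hn 0 hj)
  | succ j ih =>
    have h1 := ih (by omega)
    have h2 : (0 : ℝ) < n (j + 1) := by exact_mod_cast hn _ hj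
    simp only [effSize]
    positivity

/-- Each component of the forward vector is at most `M ^ 2` over the effective sample size. The
bound has `M ^ 2` rather than `‖σ_j ^ 2‖` in it because the latter may decrease in `j`, whereas
`x ↦ x / (x + c)` increases. -/
theorem fwdMSE_mul_effSize_le {M : ℝ} (hn : ∀ j < k, 1 ≤ n j)
    (hσ : ∀ j < k, ∀ i, 0 < σ j i ∧ σ j i ≤ M) {j : ℕ} (hj : j < k) (i : Fin m) :
    fwdMSE n σ d j i * effSize n σ d j ≤ M ^ 2 := by
  have hσ0 : ∀ j < k, ∀ i, 0 < σ j i := fun j hj i => (hσ j hj i).1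
  have hM : 0 < M := (hσ j hj i).1.trans_le (hσ j hj i).2
  have hsq : ∀ j < k, ∀ i, σ j i ^ 2 ≤ M ^ 2 := fun j hj i =>
    pow_le_pow_left₀ (hσ j hj i).1.le (hσ j hj i).2 2
  induction j with
  | zero =>
    have h1 : (0 : ℝ) < n 0 := by exact_mod_cast hn 0 hj
    simp only [fwdMSE, effSize, singleMSE]
    rw [div_mul_cancel₀ _ h1.ne']
    exact hsq 0 hj i
  | succ j ih =>
    have hj' : j < k := by omega
    have hN := effSize_pos (σ := σ) (d := d) hn hj'
    have hN' := effSize_pos (σ := σ) (d := d) hn hj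
    have hf := fwdMSE_pos (d := d) hn hσ0 hj' i
    have hn1 : (0 : ℝ) < n (j + 1) := by exact_mod_cast hn _ hj
    have hσi := pow_pos (hσ0 _ hj i) 2
    have ih := ih hj'
    set S := ‖fun i => σ (j + 1) i ^ 2‖
    set D := ‖fun i => d (j + 1) i ^ 2‖
    have hS0 : 0 < S := hσi.trans_le
      ((le_abs_self _).trans (norm_le_pi_norm (fun i => σ (j + 1) i ^ 2) i))
    have hS : S ≤ M ^ 2 := (pi_norm_le_iff_of_nonneg (by positivity)).2 fun i => by
      rw [Real.norm_of_nonneg (by positivity)]; exact hsq _ hj i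
    have hD : d (j + 1) i ^ 2 ≤ D :=
      (le_abs_self _).trans (norm_le_pi_norm (fun i => d (j + 1) i ^ 2) i)
    have hD0 : 0 ≤ D := norm_nonneg _
    have h3 := sq_nonneg (d (j + 1) i)
    set N := effSize n σ d j
    -- the two precisions that add up to the inverse of the forward vector, times `M ^ 2`
    have hA : (n (j + 1) : ℝ) ≤ M ^ 2 * (1 / singleMSE n σ (j + 1) i) := by
      simp only [singleMSE]
      rw [one_div_div, mul_div_assoc', le_div_iff₀ hσi, mul_comm]
      exact mul_le_mul_of_nonneg_right (hsq _ hj i) hn1.le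
    have hB : N * (S / (S + N * D)) ≤ M ^ 2 * (1 / (fwdMSE n σ d j i + d (j + 1) i ^ 2)) := by
      rw [mul_div_assoc', mul_one_div, div_le_div_iff₀ (by positivity) (by positivity)]
      have e1 : S * (fwdMSE n σ d j i * N) ≤ S * M ^ 2 := mul_le_mul_of_nonneg_left ih hS0.le
      have e2 : S * N * d (j + 1) i ^ 2 ≤ M ^ 2 * N * D := by gcongr
      nlinarith
    have hpos : 0 < 1 / singleMSE n σ (j + 1) i + 1 / (fwdMSE n σ d j i + d (j + 1) i ^ 2) := by
      have := singleMSE_pos hn hσ0 hj i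
      positivity
    simp only [fwdMSE]
    rw [inv_mul_le_iff₀ hpos, effSize, add_mul]
    linarith

theorem sqrt_fwdMSE_le {M : ℝ} (hn : ∀ j < k, 1 ≤ n j)
    (hσ : ∀ j < k, ∀ i, 0 < σ j i ∧ σ j i ≤ M) {j : ℕ} (hj : j < k) (i : Fin m) :
    √(fwdMSE n σ d j i) ≤ M / √(effSize n σ d j) := by
  have hN := effSize_pos (σ := σ) (d := d) hn hj
  have hM : 0 ≤ M := (hσ j hj i).1.le.trans (hσ j hj i).2
  rw [le_div_iff₀ (Real.sqrt_pos.2 hN), ← Real.sqrt_mul' _ hN.le]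
  exact Real.sqrt_le_left hM |>.2 (fwdMSE_mul_effSize_le hn hσ hj i)

end Recursion


/-! ### Integration against the samples, given the tasks -/

section Samples

variable {Ω X Y : Type*} [MeasurableSpace Ω] [MeasurableSpace X] [MeasurableSpace Y]
  {P : Measure Ω} {k : ℕ} {n : ℕ → ℕ} {p : ℕ → Kernel Ω (X × Y)} {Z : ℕ → ℕ → Ω → X × Y}

/-- The indices `(j, i)` of the samples. -/
def sampleIdx (k : ℕ) (n : ℕ → ℕ) : Finset ((_ : ℕ) × ℕ) :=
  (Finset.range k).sigma fun j => Finset.range (n j)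

/-- The vector of the task distributions. -/
def taskVec (k : ℕ) (p : ℕ → Kernel Ω (X × Y)) (ω : Ω) : Fin k → Measure (X × Y) :=
  fun j => p j ω

theorem measurable_taskVec : Measurable (taskVec k p) :=
  measurable_pi_iff.2 fun j => (p j).measurable

theorem measurable_prod_lintegral (T : Finset ((_ : ℕ) × ℕ))
    {f : ((_ : ℕ) × ℕ) → X × Y → ENNReal} (hf : ∀ a, Measurable (f a)) :
    Measurable fun ω => ∏ a ∈ T, ∫⁻ z, f a z ∂p a.1 ω :=
  Finset.measurable_prod _ fun a _ => (hf a).lintegral_kernel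

/-- The defining property of the samples, extended from indicators to arbitrary nonnegative
functions, one sample index at a time. -/
theorem AreSamples.setLIntegral_prod_aux [IsFiniteMeasure P] (hZ : AreSamples P k n p Z)
    {S : Set (Fin k → Measure (X × Y))} (hS : MeasurableSet S) (D : Finset ((_ : ℕ) × ℕ))
    (hD : D ⊆ sampleIdx k n) :
    ∀ f : ((_ : ℕ) × ℕ) → X × Y → ENNReal, (∀ a, Measurable (f a)) →
      (∀ a ∉ D, ∃ A, MeasurableSet A ∧ f a = A.indicator 1) →
      ∫⁻ ω in taskVec k p ⁻¹' S, ∏ a ∈ sampleIdx k n, f a (Z a.1 a.2 ω) ∂P =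
        ∫⁻ ω in taskVec k p ⁻¹' S, ∏ a ∈ sampleIdx k n, ∫⁻ z, f a z ∂p a.1 ω ∂P := by
  classical
  have hZm : ∀ a ∈ sampleIdx k n, Measurable (Z a.1 a.2) := fun a ha => by
    obtain ⟨h1, h2⟩ := Finset.mem_sigma.1 ha
    exact hZ.measurable _ (Finset.mem_range.1 h1) _ (Finset.mem_range.1 h2)
  induction D using Finset.induction_on with
  | empty =>
    intro f hf hind
    choose A hAm hA using fun a => hind a (Finset.notMem_empty a)
    have hset : MeasurableSet {ω | ∀ a ∈ sampleIdx k n, Z a.1 a.2 ω ∈ A a} := by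
      simp only [Set.ofPred_forall]
      exact Finset.measurableSet_biInter _ fun a ha => hZm a ha (hAm a)
    have h1 : ∀ ω, ∏ a ∈ sampleIdx k n, f a (Z a.1 a.2 ω) =
        {ω | ∀ a ∈ sampleIdx k n, Z a.1 a.2 ω ∈ A a}.indicator 1 ω := by
      intro ω
      by_cases hω : ∀ a ∈ sampleIdx k n, Z a.1 a.2 ω ∈ A a
      · rw [Set.indicator_of_mem (by exact hω)]
        exact Finset.prod_eq_one fun a ha => by rw [hA, Set.indicator_of_mem (hω a ha)]; rfl
      · rw [Set.indicator_of_notMem (by exact hω)]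
        push Not at hω
        obtain ⟨a, ha, haA⟩ := hω
        exact Finset.prod_eq_zero ha (by rw [hA, Set.indicator_of_notMem haA])
    have h2 : ∀ a ω, ∫⁻ z, f a z ∂p a.1 ω = p a.1 ω (A a) := fun a ω => by
      rw [hA, lintegral_indicator_one (hAm a)]
    simp_rw [h1, h2]
    rw [lintegral_indicator_one hset, Measure.restrict_apply hset, sampleIdx]
    simp_rw [Finset.prod_sigma]
    refine Eq.trans ?_ (hZ.law S hS (fun j i => A ⟨j, i⟩) fun j i => hAm _)
    congr 1
    ext ω
    simp only [Set.mem_inter_iff, Set.mem_preimage, Set.mem_ofPred_eq, Finset.mem_sigma,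
      Finset.mem_range, and_imp, Sigma.forall]
    tauto
  | insert b D hb ih =>
    intro f hf hind
    have hbT : b ∈ sampleIdx k n := hD (Finset.mem_insert_self _ _)
    set ν := P.restrict (taskVec k p ⁻¹' S)
    set F : Ω → ENNReal := fun ω => ∏ a ∈ (sampleIdx k n).erase b, f a (Z a.1 a.2 ω)
    set G : Ω → ENNReal := fun ω => ∏ a ∈ (sampleIdx k n).erase b, ∫⁻ z, f a z ∂p a.1 ω
    have hF : Measurable F := Finset.measurable_prod _ fun a ha =>
      (hf a).comp (hZm a (Finset.mem_of_mem_erase ha))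
    have hG : Measurable G := measurable_prod_lintegral _ hf
    -- both sides are integrals of `f b`, against measures that agree by the induction hypothesis
    have hmeas : (ν.withDensity F).map (Z b.1 b.2) = (ν.withDensity G).bind (p b.1) := by
      ext A hA
      have := ih (fun a ha => hD (Finset.mem_insert_of_mem ha))
        (Function.update f b (A.indicator 1))
        (fun a => by
          by_cases h : a = b
          · subst h; simpa using measurable_one.indicator hA
          · simpa [h] using hf a)
        (fun a ha => by
          by_cases h : a = b
          · subst h; exact ⟨A, hA, by simp⟩
          · simpa [h] using hind a (by simp [h, ha]))
      simp_rw [← Finset.mul_prod_erase _ _ hbT] at this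
      simp only [Function.update_self] at this
      have e1 : ∀ ω, ∏ a ∈ (sampleIdx k n).erase b,
          Function.update f b (A.indicator 1) a (Z a.1 a.2 ω) = F ω := fun ω =>
        Finset.prod_congr rfl fun a ha => by
          rw [Function.update_of_ne (Finset.ne_of_mem_erase ha)]
      have e2 : ∀ ω, ∏ a ∈ (sampleIdx k n).erase b,
          ∫⁻ z, Function.update f b (A.indicator 1) a z ∂p a.1 ω = G ω := fun ω =>
        Finset.prod_congr rfl fun a ha => by
          rw [Function.update_of_ne (Finset.ne_of_mem_erase ha)]
      simp_rw [e1, e2, lintegral_indicator_one hA] at this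
      rw [Measure.map_apply (hZm b hbT) hA, Measure.bind_apply hA (p b.1).measurable.aemeasurable,
        lintegral_withDensity_eq_lintegral_mul _ hG ((p b.1).measurable_coe hA),
        withDensity_apply _ (hZm b hbT hA), ← lintegral_indicator (hZm b hbT hA)]
      simp_rw [Pi.mul_apply, mul_comm (G _)]
      rw [← this]
      refine lintegral_congr fun ω => ?_
      by_cases hω : Z b.1 b.2 ω ∈ A
      · rw [Set.indicator_of_mem (by exact hω), Set.indicator_of_mem hω]; simp
      · rw [Set.indicator_of_notMem (by exact hω), Set.indicator_of_notMem hω]; simp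
    have := congrArg (fun η => ∫⁻ z, f b z ∂η) hmeas
    rw [lintegral_map (hf b) (hZm b hbT),
      Measure.lintegral_bind (p b.1).measurable.aemeasurable (hf b).aemeasurable,
      lintegral_withDensity_eq_lintegral_mul _ hF
        (show Measurable fun ω => f b (Z b.1 b.2 ω) from (hf b).comp (hZm b hbT)),
      lintegral_withDensity_eq_lintegral_mul _ hG (hf b).lintegral_kernel] at this
    simp_rw [← Finset.mul_prod_erase _ _ hbT, mul_comm (f b _), mul_comm (∫⁻ z, f b z ∂p b.1 _)]
    exact this

/-- Given the tasks, the samples can be integrated out. -/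
theorem AreSamples.lintegral_prod [IsFiniteMeasure P] (hZ : AreSamples P k n p Z)
    {g : (Fin k → Measure (X × Y)) → ENNReal} (hg : Measurable g)
    {f : ℕ → X × Y → ENNReal} (hf : ∀ j, Measurable (f j)) :
    ∫⁻ ω, g (taskVec k p ω) *
        ∏ j ∈ Finset.range k, ∏ i ∈ Finset.range (n j), f j (Z j i ω) ∂P =
      ∫⁻ ω, g (taskVec k p ω) *
        ∏ j ∈ Finset.range k, (∫⁻ z, f j z ∂p j ω) ^ n j ∂P := by
  classical
  set F : Ω → ENNReal := fun ω =>
    ∏ j ∈ Finset.range k, ∏ i ∈ Finset.range (n j), f j (Z j i ω)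
  set G : Ω → ENNReal := fun ω => ∏ j ∈ Finset.range k, (∫⁻ z, f j z ∂p j ω) ^ n j
  have hF : Measurable F := Finset.measurable_prod _ fun j hj => Finset.measurable_prod _
    fun i hi => (hf j).comp (hZ.measurable j (Finset.mem_range.1 hj) i (Finset.mem_range.1 hi))
  have hG : Measurable G := Finset.measurable_prod _ fun j _ =>
    (hf j).lintegral_kernel.pow_const _
  have hmeas : (P.withDensity F).map (taskVec k p) = (P.withDensity G).map (taskVec k p) := by
    ext S hS
    rw [Measure.map_apply measurable_taskVec hS, Measure.map_apply measurable_taskVec hS,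
      withDensity_apply _ (measurable_taskVec hS), withDensity_apply _ (measurable_taskVec hS)]
    have := hZ.setLIntegral_prod_aux hS (sampleIdx k n) subset_rfl
      (fun a => if a ∈ sampleIdx k n then f a.1 else 1)
      (fun a => by split_ifs; exacts [hf _, measurable_one])
      (fun a ha => ⟨Set.univ, .univ, by simp [ha]⟩)
    convert this using 3 with ω ω
    · rw [Finset.prod_congr rfl fun a ha => by rw [if_pos ha], sampleIdx, Finset.prod_sigma]
    · rw [Finset.prod_congr rfl fun a ha => by rw [if_pos ha], sampleIdx, Finset.prod_sigma]
      simp [G]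
  have := congrArg (fun η => ∫⁻ q, g q ∂η) hmeas
  rw [lintegral_map hg measurable_taskVec, lintegral_map hg measurable_taskVec,
    lintegral_withDensity_eq_lintegral_mul _ hF
      (show Measurable fun ω => g (taskVec k p ω) from hg.comp measurable_taskVec),
    lintegral_withDensity_eq_lintegral_mul _ hG
      (show Measurable fun ω => g (taskVec k p ω) from hg.comp measurable_taskVec)] at this
  simp_rw [mul_comm (g _)]
  exact this

end Samples


/-! ### Changes of the mean between consecutive tasks -/

section Changes

variable {Ω X Y : Type*} [MeasurableSpace Ω] [MeasurableSpace X] [MeasurableSpace Y]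
  {P : Measure Ω} {k : ℕ} {p : ℕ → Kernel Ω (X × Y)} {φ : X × Y → ℝ} {B : ℝ}

/-- The change of the mean of `φ` from the `j`-th task to the next one. -/
def meanChange (φ : X × Y → ℝ) (p : ℕ → Kernel Ω (X × Y)) (j : ℕ) (ω : Ω) : ℝ :=
  ∫ z, φ z ∂p (j + 1) ω - ∫ z, φ z ∂p j ω

/-- The mean of a function bounded by `B`, as a function of the distribution that is measurable
on all measures: Bochner integrals against arbitrary measures are avoided by integrating the
nonnegative function `φ + B`. -/
def shiftedMean (φ : X × Y → ℝ) (B : ℝ) (q : Measure (X × Y)) : ℝ :=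
  (∫⁻ z, ENNReal.ofReal (φ z + B) ∂q).toReal - B

theorem integrable_of_abs_le (hφ : Measurable φ) (hB : ∀ z, |φ z| ≤ B) (q : Measure (X × Y))
    [IsFiniteMeasure q] : Integrable φ q :=
  .of_bound hφ.aestronglyMeasurable B (ae_of_all _ hB)

theorem measurable_shiftedMean (hφ : Measurable φ) :
    Measurable (shiftedMean φ B : Measure (X × Y) → ℝ) :=
  (Measure.measurable_lintegral (hφ.add_const B).ennreal_ofReal).ennreal_toReal.sub_const B

theorem shiftedMean_eq (hφ : Measurable φ) (hB : ∀ z, |φ z| ≤ B) (q : Measure (X × Y))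
    [IsProbabilityMeasure q] : shiftedMean φ B q = ∫ z, φ z ∂q := by
  have h0 : ∀ z, 0 ≤ φ z + B := fun z => by linarith [(abs_le.1 (hB z)).1]
  have hi := integrable_of_abs_le hφ hB q
  have hiB : Integrable (fun z => φ z + B) q := hi.add (integrable_const B)
  rw [shiftedMean, ← ofReal_integral_eq_lintegral_ofReal hiB
    (ae_of_all _ h0), ENNReal.toReal_ofReal (integral_nonneg h0), integral_add hi
    (integrable_const B)]
  simp

variable [∀ j, IsMarkovKernel (p j)]

theorem measurable_mean (hφ : Measurable φ) (hB : ∀ z, |φ z| ≤ B) (j : ℕ) :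
    Measurable fun ω => ∫ z, φ z ∂p j ω := by
  simp_rw [← shiftedMean_eq hφ hB]
  exact (measurable_shiftedMean hφ).comp (p j).measurable

/-- The change of the mean is determined, measurably, by the change of the distribution on
measurable sets: this is clear for simple functions, which approximate `φ`. -/
theorem measurable_comap_meanChange (hφ : Measurable φ) (hB : ∀ z, |φ z| ≤ B) (j : ℕ) :
    Measurable[MeasurableSpace.comap (change p j) inferInstance] (meanChange φ p j) := by
  set f : ℕ → SimpleFunc (X × Y) ℝ := fun N =>
    SimpleFunc.approxOn φ hφ Set.univ 0 (Set.mem_univ 0) N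
  refine @measurable_of_tendsto_metrizable Ω ℝ
    (MeasurableSpace.comap (change p j) inferInstance) _ _ _ _
    (fun N ω => (f N).integral (p (j + 1) ω) - (f N).integral (p j ω)) _ (fun N => ?_) ?_
  · have : (fun ω => (f N).integral (p (j + 1) ω) - (f N).integral (p j ω)) =
        (fun u : {A : Set (X × Y) // MeasurableSet A} → ℝ =>
          ∑ x ∈ (f N).range, u ⟨f N ⁻¹' {x}, (f N).measurableSet_fiber x⟩ * x) ∘ change p j := by
      ext ω
      simp only [SimpleFunc.integral_eq, Function.comp, change, smul_eq_mul]
      rw [← Finset.sum_sub_distrib]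
      exact Finset.sum_congr rfl fun x _ => by ring
    rw [this]
    refine Measurable.comp ?_ (comap_measurable (change p j))
    exact Finset.measurable_sum _ fun x _ => (measurable_pi_apply _).mul_const _
  · rw [tendsto_pi_nhds]
    intro ω
    have h : ∀ l, Filter.Tendsto (fun N => (f N).integral (p l ω)) Filter.atTop
        (nhds (∫ z, φ z ∂p l ω)) := fun l =>
      tendsto_integral_approxOn_of_measurable_of_range_subset hφ
        (integrable_of_abs_le hφ hB _) Set.univ (Set.subset_univ _)
    exact (h (j + 1)).sub (h j)

theorem EvolvingTasks.iIndepFun_meanChange (hp : EvolvingTasks P k p) (hφ : Measurable φ)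
    (hB : ∀ z, |φ z| ≤ B) : iIndepFun (fun l : Fin (k - 1) => meanChange φ p l) P := by
  have h : iIndepFun (fun l : {l : ℕ // l + 1 < k} => meanChange φ p l.1) P := by
    rw [iIndepFun_iff_iIndep]
    exact iIndep_of_iIndep_of_le hp.indep.iIndep fun l =>
      (measurable_comap_meanChange hφ hB l.1).comap_le
  exact h.precomp (g := fun l : Fin (k - 1) => ⟨l.1, by omega⟩) fun a b hab =>
    Fin.ext (congrArg Subtype.val hab)

theorem EvolvingTasks.integral_meanChange [IsProbabilityMeasure P] (hp : EvolvingTasks P k p)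
    (hφ : Measurable φ) (hB : ∀ z, |φ z| ≤ B) {j : ℕ} (hj : j + 1 < k) :
    ∫ ω, meanChange φ p j ω ∂P = 0 := by
  -- the two tasks have the same averaged distribution
  have hbind : P.bind (p (j + 1)) = P.bind (p j) := by
    ext A hA
    have hint : ∀ l, Integrable (fun ω => (p l ω).real A) P := fun l =>
      .of_bound (Kernel.measurable_coe _ hA).ennreal_toReal.aestronglyMeasurable 1 <|
        ae_of_all _ fun ω => by
          rw [Real.norm_of_nonneg measureReal_nonneg]; exact measureReal_le_one
    have h0 := hp.zero_mean j hj ⟨A, hA⟩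
    simp only [change] at h0
    rw [integral_sub (hint _) (hint _), sub_eq_zero] at h0
    have hl : ∀ l, P.bind (p l) A = ENNReal.ofReal (∫ ω, (p l ω).real A ∂P) := fun l => by
      rw [Measure.bind_apply hA (p l).measurable.aemeasurable, ofReal_integral_eq_lintegral_ofReal
        (hint l) (ae_of_all _ fun ω => measureReal_nonneg)]
      exact lintegral_congr fun ω => (ofReal_measureReal (measure_ne_top _ _)).symm
    rw [hl, hl, h0]
  have hint : ∀ l, Integrable (fun ω => ∫ z, φ z ∂p l ω) P := fun l =>
    .of_bound (measurable_mean hφ hB l).aestronglyMeasurable B <| ae_of_all _ fun ω => by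
      simpa using norm_integral_le_of_norm_le_const (μ := p l ω) (f := φ) (C := B)
        (ae_of_all _ hB)
  have hl : ∀ l, ∫ ω, ∫ z, φ z ∂p l ω ∂P = shiftedMean φ B (P.bind (p l)) := fun l => by
    have hm : Measurable fun z => ENNReal.ofReal (φ z + B) := (hφ.add_const B).ennreal_ofReal
    have hfin : ∀ ω, ∫⁻ z, ENNReal.ofReal (φ z + B) ∂p l ω < ⊤ := fun ω =>
      ((integrable_of_abs_le hφ hB (p l ω)).add (integrable_const B)).lintegral_lt_top
    rw [shiftedMean, Measure.lintegral_bind (p l).measurable.aemeasurable hm.aemeasurable,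
      ← integral_toReal hm.lintegral_kernel.aemeasurable (ae_of_all _ hfin)]
    have : ∀ ω, (∫⁻ z, ENNReal.ofReal (φ z + B) ∂p l ω).toReal = ∫ z, φ z ∂p l ω + B :=
      fun ω => by rw [← shiftedMean_eq hφ hB, shiftedMean]; ring
    simp_rw [this]
    rw [integral_add (hint l) (integrable_const B)]
    simp
  unfold meanChange
  rw [integral_sub (hint _) (hint _), hl, hl, hbind, sub_self]

/-- Linear combinations of the changes of the mean are sub-Gaussian. -/
theorem EvolvingTasks.hasSubgaussianMGF_sum_meanChange [IsProbabilityMeasure P]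
    (hp : EvolvingTasks P k p) (hφ : Measurable φ) (hB : ∀ z, |φ z| ≤ B) {κ : ℝ} {δ : ℕ → ℝ}
    (hsub : ∀ j, j + 1 < k → IsSubG (meanChange φ p j) (κ * δ j) P) (b : ℕ → ℝ) :
    HasSubgaussianMGF (fun ω => ∑ l ∈ Finset.range (k - 1), b l * meanChange φ p l ω)
      (Real.toNNReal (κ ^ 2 * ∑ l ∈ Finset.range (k - 1), b l ^ 2 * δ l ^ 2)) P := by
  have hind : iIndepFun (fun (l : Fin (k - 1)) ω => b l * meanChange φ p l ω) P :=
    (hp.iIndepFun_meanChange hφ hB).comp (fun l x => b l * x) fun l => measurable_const_mul _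
  have h1 : ∀ l : Fin (k - 1), HasSubgaussianMGF (fun ω => b l * meanChange φ p l ω)
      (Real.toNNReal (κ ^ 2 * (b l ^ 2 * δ l ^ 2))) P := fun l => by
    have h := hsub l (by omega)
    rw [IsSubG, hp.integral_meanChange hφ hB (by omega)] at h
    simp only [sub_zero] at h
    convert h.const_mul (b l) using 1
    rw [← NNReal.coe_inj, Real.coe_toNNReal _ (by positivity)]
    change _ = b l ^ 2 * (κ * δ l) ^ 2
    ring
  have h2 := HasSubgaussianMGF.sum_of_iIndepFun hind (s := Finset.univ) fun l _ => h1 l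
  convert h2 using 1
  · ext ω
    exact Finset.sum_range _
  · rw [← Real.toNNReal_sum_of_nonneg fun l _ => by positivity, Finset.mul_sum, Finset.sum_range]

end Changes


/-! ### Sub-Gaussian errors of the forward estimates -/

section Errors

variable {Ω X Y : Type*} [MeasurableSpace Ω] [MeasurableSpace X] [MeasurableSpace Y]
  {P : Measure Ω} {k : ℕ} {n : ℕ → ℕ} {p : ℕ → Kernel Ω (X × Y)} {Z : ℕ → ℕ → Ω → X × Y}
  {φ : X × Y → ℝ} {B : ℝ}

/-- The error of the `j`-th sample mean of `φ`. -/
def sampleErr (φ : X × Y → ℝ) (n : ℕ → ℕ) (p : ℕ → Kernel Ω (X × Y)) (Z : ℕ → ℕ → Ω → X × Y)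
    (j : ℕ) (ω : Ω) : ℝ :=
  1 / (n j : ℝ) * ∑ l ∈ Finset.range (n j), φ (Z j l ω) - ∫ z, φ z ∂p j ω

/-- The error of a forward estimate is a linear combination of the errors of the sample means and of
the changes between tasks. If the summands are thought of as uncorrelated, with variances
`s_l` and `d_{l+1} ^ 2`, its variance is the forward vector. -/
theorem exists_fwdMean_sub_eq {m : ℕ} {Φ : X × Y → Fin m → ℝ} {σ d : ℕ → Fin m → ℝ}
    (hn : ∀ j < k, 1 ≤ n j) (hσ : ∀ j < k, ∀ i, 0 < σ j i) (i : Fin m) {j : ℕ} (hj : j < k) :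
    ∃ c b : ℕ → ℝ, (∀ l, j < l → c l = 0) ∧ (∀ l, j ≤ l → b l = 0) ∧
      (∀ ω, fwdMean Φ n Z σ d j ω i - meanVec Φ (p j ω) i =
        ∑ l ∈ Finset.range k, c l * sampleErr (fun z => Φ z i) n p Z l ω
          + ∑ l ∈ Finset.range (k - 1), b l * meanChange (fun z => Φ z i) p l ω) ∧
      ∑ l ∈ Finset.range k, c l ^ 2 * singleMSE n σ l i
        + ∑ l ∈ Finset.range (k - 1), b l ^ 2 * d (l + 1) i ^ 2 = fwdMSE n σ d j i := by
  induction j with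
  | zero =>
    refine ⟨fun l => if l = 0 then 1 else 0, 0, fun l hl => if_neg (by omega), fun _ _ => rfl,
      fun ω => ?_, ?_⟩
    · simp [hj, sampleErr, fwdMean, sampleMean, meanVec]
    · simp [hj, fwdMSE]
  | succ j ih =>
    obtain ⟨c, b, hc, hb, he, hv⟩ := ih (by omega)
    set g := gain n σ d j i with hg
    have hj1 : j ∈ Finset.range (k - 1) := Finset.mem_range.2 (by omega)
    have hjk : j + 1 ∈ Finset.range k := Finset.mem_range.2 hj
    refine ⟨fun l => g * c l + if l = j + 1 then 1 - g else 0,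
      fun l => g * b l - if l = j then g else 0, fun l hl => ?_, fun l hl => ?_, fun ω => ?_, ?_⟩
    · simp [hc l (by omega), show l ≠ j + 1 by omega]
    · simp [hb l (by omega), show l ≠ j by omega]
    · simp only [add_mul, sub_mul, Finset.sum_add_distrib, Finset.sum_sub_distrib, ite_mul,
        zero_mul, Finset.sum_ite_eq', hj1, hjk, if_true, mul_assoc, ← Finset.mul_sum]
      have h1 : sampleMean Φ n Z (j + 1) ω i
          = sampleErr (fun z => Φ z i) n p Z (j + 1) ω + meanVec Φ (p (j + 1) ω) i := by
        simp [sampleErr, sampleMean, meanVec]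
      have h2 : meanChange (fun z => Φ z i) p j ω
          = meanVec Φ (p (j + 1) ω) i - meanVec Φ (p j ω) i := rfl
      have h3 : fwdMean Φ n Z σ d (j + 1) ω i = sampleMean Φ n Z (j + 1) ω i
          + g * (fwdMean Φ n Z σ d j ω i - sampleMean Φ n Z (j + 1) ω i) := rfl
      rw [h3, h1, h2]
      linear_combination g * he ω
    · rw [fwdMSE_succ_eq hn hσ hj, ← hg, ← hv]
      have h1 : ∀ l, (g * c l + if l = j + 1 then 1 - g else 0) ^ 2 * singleMSE n σ l i
          = g ^ 2 * (c l ^ 2 * singleMSE n σ l i)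
            + if l = j + 1 then (1 - g) ^ 2 * singleMSE n σ l i else 0 := fun l => by
        split_ifs with h
        · rw [hc l (by omega)]; ring
        · ring
      have h2 : ∀ l, (g * b l - if l = j then g else 0) ^ 2 * d (l + 1) i ^ 2
          = g ^ 2 * (b l ^ 2 * d (l + 1) i ^ 2)
            + if l = j then g ^ 2 * d (l + 1) i ^ 2 else 0 := fun l => by
        split_ifs with h
        · rw [hb l (by omega)]; ring
        · ring
      simp only [h1, h2, Finset.sum_add_distrib, Finset.sum_ite_eq', hj1, hjk, if_true,
        ← Finset.mul_sum]
      ring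

variable [∀ j, IsMarkovKernel (p j)]

theorem AreSamples.measurable_sampleErr (hZ : AreSamples P k n p Z) (hφ : Measurable φ)
    (hB : ∀ z, |φ z| ≤ B) {j : ℕ} (hj : j < k) : Measurable (sampleErr φ n p Z j) :=
  ((Finset.measurable_sum _ fun i hi => hφ.comp
    (hZ.measurable j hj i (Finset.mem_range.1 hi))).const_mul _).sub (measurable_mean hφ hB j)

/-- The exponential moment of the average of `N` independent copies, before centering. -/
theorem lintegral_exp_pow_le {q : Measure (X × Y)} [IsProbabilityMeasure q]
    {s : ℝ} (hs : IsSubG φ s q) {N : ℕ} (hN : 1 ≤ N) (t : ℝ) :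
    (∫⁻ z, ENNReal.ofReal (Real.exp (t / N * φ z)) ∂q) ^ N ≤
      ENNReal.ofReal (Real.exp (t * ∫ z, φ z ∂q + t ^ 2 * (s ^ 2 / N) / 2)) := by
  have hN0 : (N : ℝ) ≠ 0 := by exact_mod_cast (by omega : N ≠ 0)
  set μ := ∫ z, φ z ∂q
  set r := t / (N : ℝ)
  have hfun : ∀ z, Real.exp (r * φ z) = Real.exp (r * μ) * Real.exp (r * (φ z - μ)) := fun z => by
    rw [← Real.exp_add]; ring_nf
  have hint : Integrable (fun z => Real.exp (r * φ z)) q := by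
    simp_rw [hfun]
    exact (hs.integrable_exp_mul r).const_mul _
  have hmgf : ∫ z, Real.exp (r * (φ z - μ)) ∂q ≤ Real.exp (s ^ 2 * r ^ 2 / 2) := hs.mgf_le r
  rw [← ofReal_integral_eq_lintegral_ofReal hint (ae_of_all _ fun z => (Real.exp_pos _).le),
    ← ENNReal.ofReal_pow (integral_nonneg fun z => (Real.exp_pos _).le)]
  refine ENNReal.ofReal_le_ofReal ?_
  have h1 : ∫ z, Real.exp (r * φ z) ∂q ≤ Real.exp (r * μ + s ^ 2 * r ^ 2 / 2) := by
    simp_rw [hfun]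
    rw [integral_const_mul, Real.exp_add]
    exact mul_le_mul_of_nonneg_left hmgf (Real.exp_pos _).le
  refine (pow_le_pow_left₀ (integral_nonneg fun z => (Real.exp_pos _).le) h1 N).trans_eq ?_
  rw [← Real.exp_nat_mul]
  congr 1
  simp only [r]
  field_simp

/-- The means of `φ` in the tasks, as measurable functions of the vector of task distributions. -/
def taskMean (φ : X × Y → ℝ) (B : ℝ) (k l : ℕ) (q : Fin k → Measure (X × Y)) : ℝ :=
  if h : l < k then shiftedMean φ B (q ⟨l, h⟩) else 0

theorem measurable_taskMean (hφ : Measurable φ) (l : ℕ) :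
    Measurable (taskMean φ B k l : (Fin k → Measure (X × Y)) → ℝ) := by
  unfold taskMean
  split_ifs with h
  · exact (measurable_shiftedMean hφ).comp (measurable_pi_apply _)
  · exact measurable_const

theorem taskMean_taskVec (hφ : Measurable φ) (hB : ∀ z, |φ z| ≤ B) {l : ℕ} (hl : l < k) (ω : Ω) :
    taskMean φ B k l (taskVec k p ω) = ∫ z, φ z ∂p l ω := by
  rw [taskMean, dif_pos hl]
  exact shiftedMean_eq hφ hB (p l ω)

/-- Given the tasks, the errors of the sample means contribute their conditional variance proxies to
exponential moments. -/
theorem AreSamples.lintegral_exp_error_le [IsFiniteMeasure P] (hZ : AreSamples P k n p Z)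
    (hn : ∀ j < k, 1 ≤ n j) (hφ : Measurable φ) (hB : ∀ z, |φ z| ≤ B) {s : ℕ → ℝ}
    (hs : ∀ j < k, ∀ᵐ ω ∂P, IsSubG φ (s j) (p j ω)) (c b : ℕ → ℝ) (t : ℝ) :
    ∫⁻ ω, ENNReal.ofReal (Real.exp (t * (∑ l ∈ Finset.range k, c l * sampleErr φ n p Z l ω
        + ∑ l ∈ Finset.range (k - 1), b l * meanChange φ p l ω))) ∂P ≤
      ENNReal.ofReal (Real.exp (t ^ 2 * (∑ l ∈ Finset.range k, c l ^ 2 * (s l ^ 2 / n l)) / 2)) *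
        ∫⁻ ω, ENNReal.ofReal
          (Real.exp (t * ∑ l ∈ Finset.range (k - 1), b l * meanChange φ p l ω)) ∂P := by
  set f : ℕ → X × Y → ENNReal := fun j z => ENNReal.ofReal (Real.exp (t * c j / n j * φ z))
  set g : (Fin k → Measure (X × Y)) → ENNReal := fun q => ENNReal.ofReal (Real.exp
    (t * ∑ l ∈ Finset.range (k - 1), b l * (taskMean φ B k (l + 1) q - taskMean φ B k l q)
      - ∑ l ∈ Finset.range k, t * c l * taskMean φ B k l q))
  have hf : ∀ j, Measurable (f j) := fun j =>
    (Real.measurable_exp.comp (hφ.const_mul _)).ennreal_ofReal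
  have hg : Measurable g := by
    refine (Real.measurable_exp.comp (((Finset.measurable_sum _ fun l _ => ?_).const_mul t).sub
      (Finset.measurable_sum _ fun l _ => ?_))).ennreal_ofReal
    · exact ((measurable_taskMean hφ _).sub (measurable_taskMean hφ _)).const_mul _
    · exact (measurable_taskMean hφ _).const_mul _
  have hgω : ∀ ω, g (taskVec k p ω) = ENNReal.ofReal (Real.exp
      (t * ∑ l ∈ Finset.range (k - 1), b l * meanChange φ p l ω
        - ∑ l ∈ Finset.range k, t * c l * ∫ z, φ z ∂p l ω)) := by
    intro ω
    simp only [g]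
    congr 3
    · congr 1
      refine Finset.sum_congr rfl fun l hl => ?_
      have := Finset.mem_range.1 hl
      rw [taskMean_taskVec hφ hB (by omega), taskMean_taskVec hφ hB (by omega)]
      rfl
    · exact Finset.sum_congr rfl fun l hl => by
        rw [taskMean_taskVec hφ hB (Finset.mem_range.1 hl)]
  have hsplit : ∀ ω, ENNReal.ofReal (Real.exp (t * (∑ l ∈ Finset.range k,
      c l * sampleErr φ n p Z l ω + ∑ l ∈ Finset.range (k - 1), b l * meanChange φ p l ω))) =
      g (taskVec k p ω) *
        ∏ j ∈ Finset.range k, ∏ i ∈ Finset.range (n j), f j (Z j i ω) := by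
    intro ω
    have h1 : ∏ j ∈ Finset.range k, ∏ i ∈ Finset.range (n j), f j (Z j i ω) =
        ENNReal.ofReal (Real.exp (∑ j ∈ Finset.range k, ∑ i ∈ Finset.range (n j),
          t * c j / n j * φ (Z j i ω))) := by
      simp_rw [Real.exp_sum]
      rw [ENNReal.ofReal_prod_of_nonneg fun j _ => Finset.prod_nonneg fun i _ =>
        (Real.exp_pos _).le]
      exact Finset.prod_congr rfl fun j _ =>
        (ENNReal.ofReal_prod_of_nonneg fun i _ => (Real.exp_pos _).le).symm
    rw [h1, hgω, ← ENNReal.ofReal_mul (Real.exp_pos _).le, ← Real.exp_add]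
    congr 2
    have h2 : ∀ j, t * (c j * sampleErr φ n p Z j ω) =
        ∑ i ∈ Finset.range (n j), t * c j / n j * φ (Z j i ω) - t * c j * ∫ z, φ z ∂p j ω := by
      intro j
      rw [sampleErr, ← Finset.mul_sum]
      ring
    rw [mul_add, Finset.mul_sum (Finset.range k)]
    simp_rw [h2]
    rw [Finset.sum_sub_distrib]
    ring
  simp_rw [hsplit]
  rw [hZ.lintegral_prod hg hf, ← lintegral_const_mul' _ _ ENNReal.ofReal_ne_top]
  have hs' : ∀ᵐ ω ∂P, ∀ j ∈ Finset.range k, IsSubG φ (s j) (p j ω) :=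
    (Finset.range k).eventually_all.2 fun j hj => hs j (Finset.mem_range.1 hj)
  refine lintegral_mono_ae ?_
  filter_upwards [hs'] with ω hω
  have hprod : ∏ j ∈ Finset.range k, (∫⁻ z, f j z ∂p j ω) ^ n j ≤
      ENNReal.ofReal (Real.exp (∑ j ∈ Finset.range k, (t * c j * ∫ z, φ z ∂p j ω
        + (t * c j) ^ 2 * (s j ^ 2 / n j) / 2))) := by
    rw [Real.exp_sum, ENNReal.ofReal_prod_of_nonneg fun j _ => (Real.exp_pos _).le]
    exact Finset.prod_le_prod' fun j hj =>
      lintegral_exp_pow_le (hω j hj) (hn j (Finset.mem_range.1 hj)) _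
  refine (mul_le_mul_right hprod _).trans_eq ?_
  rw [hgω, ← ENNReal.ofReal_mul (Real.exp_pos _).le, ← Real.exp_add,
    ← ENNReal.ofReal_mul (Real.exp_pos _).le, ← Real.exp_add, Finset.sum_add_distrib]
  congr 2
  have : ∑ j ∈ Finset.range k, (t * c j) ^ 2 * (s j ^ 2 / n j) / 2
      = t ^ 2 * (∑ l ∈ Finset.range k, c l ^ 2 * (s l ^ 2 / n l)) / 2 := by
    rw [Finset.mul_sum, Finset.sum_div]
    exact Finset.sum_congr rfl fun j _ => by ring
  rw [this]
  ring

/-- Linear combinations of the errors of the sample means and of the changes between tasks are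
sub-Gaussian, as if all of them were independent. -/
theorem hasSubgaussianMGF_error [IsProbabilityMeasure P] (hp : EvolvingTasks P k p)
    (hZ : AreSamples P k n p Z) (hn : ∀ j < k, 1 ≤ n j) (hφ : Measurable φ)
    (hB : ∀ z, |φ z| ≤ B) {κ : ℝ} {s δ : ℕ → ℝ}
    (hs : ∀ j < k, ∀ᵐ ω ∂P, IsSubG φ (κ * s j) (p j ω))
    (hδ : ∀ j, j + 1 < k → IsSubG (meanChange φ p j) (κ * δ j) P) (c b : ℕ → ℝ) :
    HasSubgaussianMGF (fun ω => ∑ l ∈ Finset.range k, c l * sampleErr φ n p Z l ω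
        + ∑ l ∈ Finset.range (k - 1), b l * meanChange φ p l ω)
      (Real.toNNReal (κ ^ 2 * (∑ l ∈ Finset.range k, c l ^ 2 * (s l ^ 2 / n l)
        + ∑ l ∈ Finset.range (k - 1), b l ^ 2 * δ l ^ 2))) P := by
  have hw := hp.hasSubgaussianMGF_sum_meanChange hφ hB hδ b
  set V := ∑ l ∈ Finset.range k, c l ^ 2 * (s l ^ 2 / n l)
  set W := ∑ l ∈ Finset.range (k - 1), b l ^ 2 * δ l ^ 2
  have hV : 0 ≤ V := Finset.sum_nonneg fun l _ => by positivity
  have hW : 0 ≤ W := Finset.sum_nonneg fun l _ => by positivity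
  have hem : Measurable fun ω => ∑ l ∈ Finset.range k, c l * sampleErr φ n p Z l ω
      + ∑ l ∈ Finset.range (k - 1), b l * meanChange φ p l ω :=
    (Finset.measurable_sum _ fun l hl =>
      (hZ.measurable_sampleErr hφ hB (Finset.mem_range.1 hl)).const_mul _).add
    (Finset.measurable_sum _ fun l _ =>
      ((measurable_mean hφ hB _).sub (measurable_mean hφ hB _)).const_mul _)
  set e := fun ω => ∑ l ∈ Finset.range k, c l * sampleErr φ n p Z l ω
      + ∑ l ∈ Finset.range (k - 1), b l * meanChange φ p l ω
  have hle : ∀ t, ∫⁻ ω, ENNReal.ofReal (Real.exp (t * e ω)) ∂P ≤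
      ENNReal.ofReal (Real.exp (κ ^ 2 * (V + W) * t ^ 2 / 2)) := by
    intro t
    refine (hZ.lintegral_exp_error_le hn hφ hB hs c b t).trans ?_
    rw [← ofReal_integral_eq_lintegral_ofReal (hw.integrable_exp_mul t)
      (ae_of_all _ fun ω => (Real.exp_pos _).le), ← ENNReal.ofReal_mul (Real.exp_pos _).le]
    refine ENNReal.ofReal_le_ofReal ?_
    have h1 := hw.mgf_le t
    rw [Real.coe_toNNReal _ (by positivity)] at h1
    refine (mul_le_mul_of_nonneg_left h1 (Real.exp_pos _).le).trans_eq ?_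
    rw [← Real.exp_add]
    congr 1
    have : ∑ l ∈ Finset.range k, c l ^ 2 * ((κ * s l) ^ 2 / n l) = κ ^ 2 * V := by
      rw [Finset.mul_sum]
      exact Finset.sum_congr rfl fun l _ => by ring
    rw [this]
    ring
  have hexp : ∀ t, Integrable (fun ω => Real.exp (t * e ω)) P := fun t =>
    (lintegral_ofReal_ne_top_iff_integrable
      (Real.measurable_exp.comp (hem.const_mul t)).aestronglyMeasurable
      (ae_of_all _ fun ω => (Real.exp_pos _).le)).1
      ((hle t).trans_lt ENNReal.ofReal_lt_top).ne
  refine ⟨hexp, fun t => ?_⟩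
  rw [Real.coe_toNNReal _ (by positivity)]
  have := hle t
  rw [← ofReal_integral_eq_lintegral_ofReal (hexp t) (ae_of_all _ fun ω => (Real.exp_pos _).le),
    ENNReal.ofReal_le_ofReal_iff (Real.exp_pos _).le] at this
  exact this

end Errors


/-! ### Concentration and conclusion -/

/-- Two-sided Chernoff bound, valid for `κ = 0` too, where the variable vanishes almost surely. -/
theorem measureReal_lt_abs_le {Ω : Type*} [MeasurableSpace Ω] {P : Measure Ω}
    [IsProbabilityMeasure P] {e : Ω → ℝ} {κ v L : ℝ} (hκ : 0 ≤ κ) (hv : 0 < v) (hL : 0 ≤ L)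
    (he : HasSubgaussianMGF e (Real.toNNReal (κ ^ 2 * v)) P) :
    P.real {ω | κ * √v * √(2 * L) < |e ω|} ≤ 2 * Real.exp (-L) := by
  obtain rfl | hκ := hκ.eq_or_lt
  · have h0 : e =ᵐ[P] 0 := by
      refine HasSubgaussianMGF.ae_eq_zero_of_hasSubgaussianMGF_zero ?_
      simpa using he
    have : P {ω | 0 * √v * √(2 * L) < |e ω|} = 0 :=
      measure_eq_zero_iff_ae_notMem.2 <| h0.mono fun ω h => by simp [h]
    rw [Measure.real, this]
    simpa using (Real.exp_pos (-L)).le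
  · set ε := κ * √v * √(2 * L)
    have hε : 0 ≤ ε := by positivity
    have hval : -ε ^ 2 / (2 * (Real.toNNReal (κ ^ 2 * v) : ℝ)) = -L := by
      rw [Real.coe_toNNReal _ (by positivity)]
      simp only [ε]
      rw [mul_pow, mul_pow, Real.sq_sqrt hv.le, Real.sq_sqrt (by positivity)]
      field_simp
    have h1 := he.measure_ge_le hε
    have h2 := he.neg.measure_ge_le hε
    rw [hval] at h1 h2
    have hsub : {ω | ε < |e ω|} ⊆ {ω | ε ≤ e ω} ∪ {ω | ε ≤ (-e) ω} := fun ω hω => by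
      rcases lt_abs.1 (show ε < |e ω| from hω) with h | h
      · exact Or.inl h.le
      · exact Or.inr h.le
    calc P.real {ω | ε < |e ω|} ≤ P.real ({ω | ε ≤ e ω} ∪ {ω | ε ≤ (-e) ω}) :=
          measureReal_mono hsub
      _ ≤ P.real {ω | ε ≤ e ω} + P.real {ω | ε ≤ (-e) ω} := measureReal_union_le _ _
      _ ≤ 2 * Real.exp (-L) := by linarith

theorem one_le_sqrt_two_mul_log {m : ℕ} (hm : 1 ≤ m) {δ : ℝ} (h0 : 0 < δ) (h1 : δ < 1) :
    1 ≤ √(2 * Real.log (2 * m / δ)) := by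
  have hm' : (1 : ℝ) ≤ m := by exact_mod_cast hm
  have h2 : 2 ≤ 2 * (m : ℝ) / δ := by
    rw [le_div_iff₀ h0]
    nlinarith
  have h3 := Real.log_le_log two_pos h2
  have h4 := Real.log_two_gt_d9
  rw [Real.one_le_sqrt]
  linarith

/-- With probability at least `1 - δ` the forward estimate is off by at most
`κ √(2 log (2m/δ))` times the confidence vector in each component. -/
theorem exists_event_fwdMean_error {Ω X Y : Type*} [MeasurableSpace Ω] [MeasurableSpace X]
    [MeasurableSpace Y] {P : Measure Ω} [IsProbabilityMeasure P] {m : ℕ} (hm : 1 ≤ m)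
    {Φ : X × Y → Fin m → ℝ} (hΦ : Measurable Φ) {M : ℝ} (hM : ∀ z i, |Φ z i| ≤ M)
    {k : ℕ} {n : ℕ → ℕ} (hn : ∀ j < k, 1 ≤ n j) {p : ℕ → Kernel Ω (X × Y)}
    [∀ j, IsMarkovKernel (p j)] (hp : EvolvingTasks P k p) {Z : ℕ → ℕ → Ω → X × Y}
    (hZ : AreSamples P k n p Z) {σ d : ℕ → Fin m → ℝ} (hσ : ∀ j < k, ∀ i, 0 < σ j i)
    {κ : ℝ} (hκ : 0 ≤ κ)
    (hsubΦ : ∀ j < k, ∀ᵐ ω ∂P, ∀ i, IsSubG (fun z => Φ z i) (κ * σ j i) (p j ω))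
    (hsubw : ∀ j, j + 1 < k → ∀ i, IsSubG
      (fun ω => meanVec Φ (p (j + 1) ω) i - meanVec Φ (p j ω) i) (κ * d (j + 1) i) P)
    {δ : ℝ} (h0 : 0 < δ) (h1 : δ < 1) {j : ℕ} (hj : j < k) :
    ∃ E : Set Ω, MeasurableSet E ∧ 1 - δ ≤ P.real E ∧ ∀ ω ∈ E, ∀ i,
      |fwdMean Φ n Z σ d j ω i - meanVec Φ (p j ω) i| ≤
        κ * √(fwdMSE n σ d j i) * √(2 * Real.log (2 * m / δ)) := by
  have hφ : ∀ i, Measurable fun z => Φ z i := fun i => measurable_pi_iff.1 hΦ i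
  have hφM : ∀ i z, |Φ z i| ≤ M := fun i z => hM z i
  set L := Real.log (2 * m / δ)
  set e : Fin m → Ω → ℝ := fun i ω => fwdMean Φ n Z σ d j ω i - meanVec Φ (p j ω) i
  have key : ∀ i, Measurable (e i) ∧
      P.real {ω | κ * √(fwdMSE n σ d j i) * √(2 * L) < |e i ω|} ≤ 2 * Real.exp (-L) := by
    intro i
    obtain ⟨c, b, -, -, he, hv⟩ := exists_fwdMean_sub_eq (Z := Z) (p := p) (Φ := Φ) (d := d)
      hn hσ i hj
    have he' : e i = fun ω => ∑ l ∈ Finset.range k, c l * sampleErr (fun z => Φ z i) n p Z l ω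
        + ∑ l ∈ Finset.range (k - 1), b l * meanChange (fun z => Φ z i) p l ω := funext he
    have hsub := hasSubgaussianMGF_error hp hZ hn (hφ i) (hφM i) (κ := κ) (s := fun l => σ l i)
      (δ := fun l => d (l + 1) i)
      (fun l hl => (hsubΦ l hl).mono fun ω hω => hω i) (fun l hl => hsubw l hl i) c b
    simp only [singleMSE] at hv
    rw [hv, ← he'] at hsub
    refine ⟨?_, measureReal_lt_abs_le hκ (fwdMSE_pos hn hσ hj i) ?_ hsub⟩
    · rw [he']
      exact (Finset.measurable_sum _ fun l hl =>
        (hZ.measurable_sampleErr (hφ i) (hφM i) (Finset.mem_range.1 hl)).const_mul _).add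
        (Finset.measurable_sum _ fun l _ => ((measurable_mean (hφ i) (hφM i) _).sub
          (measurable_mean (hφ i) (hφM i) _)).const_mul _)
    · have := one_le_sqrt_two_mul_log hm h0 h1
      rw [Real.one_le_sqrt] at this
      linarith
  have hE : MeasurableSet {ω | ∀ i, |e i ω| ≤ κ * √(fwdMSE n σ d j i) * √(2 * L)} := by
    simp only [Set.ofPred_forall]
    exact MeasurableSet.iInter fun i =>
      measurableSet_le (continuous_abs.measurable.comp (key i).1) measurable_const
  refine ⟨_, hE, ?_, fun ω hω => hω⟩
  have hcompl : P.real {ω | ∀ i, |e i ω| ≤ κ * √(fwdMSE n σ d j i) * √(2 * L)}ᶜ ≤ δ := by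
    have hset : {ω | ∀ i, |e i ω| ≤ κ * √(fwdMSE n σ d j i) * √(2 * L)}ᶜ =
        ⋃ i, {ω | κ * √(fwdMSE n σ d j i) * √(2 * L) < |e i ω|} := by
      ext ω
      simp
    have hm0 : (0 : ℝ) < m := by exact_mod_cast hm
    rw [hset]
    refine (measureReal_iUnion_fintype_le _).trans
      ((Finset.sum_le_sum fun i _ => (key i).2).trans_eq ?_)
    rw [Finset.sum_const, Finset.card_univ, Fintype.card_fin, nsmul_eq_mul, Real.exp_neg,
      Real.exp_log (by positivity)]
    field_simp
  rw [probReal_compl_eq_one_sub hE] at hcompl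
  linarith

end Evolving

end

theorem theorem1
    {Ω X Y : Type*} [MeasurableSpace Ω] [MeasurableSpace X]
    [MeasurableSpace Y] [Finite Y] [MeasurableSingletonClass Y]
    (P : Measure Ω) [IsProbabilityMeasure P]
    (m : ℕ) (hm : 1 ≤ m)
    -- the feature mapping
    (Φ : X × Y → Fin m → ℝ) (hΦ : Measurable Φ)
    (M : ℝ) (hM : ∀ z i, |Φ z i| ≤ M)
    (hcompact : IsCompact (Set.range fun (x : X) (y : Y) => Φ (x, y)))
    -- the evolving tasks and their samples
    (k : ℕ) (n : ℕ → ℕ) (hn : ∀ j < k, 1 ≤ n j)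
    (p : ℕ → Kernel Ω (X × Y)) [∀ j, IsMarkovKernel (p j)]
    (hp : Evolving.EvolvingTasks P k p)
    (Z : ℕ → ℕ → Ω → X × Y) (hZ : Evolving.AreSamples P k n p Z)
    -- the values used in the recursions
    (σ d : ℕ → Fin m → ℝ)
    (hσ : ∀ j < k, ∀ i, 0 < σ j i ∧ σ j i ≤ M)
    (hd : ∀ j, j + 1 < k → ∀ i, 0 ≤ d (j + 1) i)
    (κ : ℝ) (hκ : 0 ≤ κ)
    (hsubΦ : ∀ j < k, ∀ᵐ ω ∂P, ∀ i, Evolving.IsSubG (fun z => Φ z i) (κ * σ j i) (p j ω))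
    (hsubw : ∀ j, j + 1 < k → ∀ i, Evolving.IsSubG
      (fun ω => Evolving.meanVec Φ (p (j + 1) ω) i - Evolving.meanVec Φ (p j ω) i)
      (κ * d (j + 1) i) P) :
    ∃ N : ℕ → ℝ,
      N 0 = n 0 ∧
      (∀ j, j + 1 < k →
        N (j + 1) ≥ n (j + 1) + N j *
          (‖fun i => σ (j + 1) i ^ 2‖
            / (‖fun i => σ (j + 1) i ^ 2‖ + N j * ‖fun i => d (j + 1) i ^ 2‖))) ∧
      ∀ δ : ℝ, 0 < δ → δ < 1 → ∀ j < k,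
        ∃ E : Set Ω, MeasurableSet E ∧ 1 - δ ≤ P.real E ∧
          ∀ ω ∈ E, ∀ μ : Fin m → ℝ,
            Evolving.IsMRCParameter Φ (Evolving.meanVec Φ (p j ω)) 0 μ →
            Evolving.minimaxRisk (Evolving.fwdSet Φ n Z σ d j ω) ≤
              Evolving.minimaxRisk (Evolving.exactSet Φ (Evolving.meanVec Φ (p j ω)))
                + M * (κ + 1) * √(2 * Real.log (2 * m / δ)) / √(N j) * ∑ i, |μ i| := by
  refine ⟨Evolving.effSize n σ d, rfl, fun j _ => le_rfl, fun δ h0 h1 j hj => ?_⟩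
  have hσ0 : ∀ j < k, ∀ i, 0 < σ j i := fun j hj i => (hσ j hj i).1
  obtain ⟨E, hE, hPE, hbound⟩ := Evolving.exists_event_fwdMean_error hm hΦ hM hn hp hZ hσ0 hκ
    hsubΦ hsubw h0 h1 hj
  refine ⟨E, hE, hPE, fun ω hω μ hμ => ?_⟩
  obtain ⟨z⟩ : Nonempty (X × Y) := (p j ω).nonempty_of_neZero
  have : Nonempty X := ⟨z.1⟩
  have : Nonempty Y := ⟨z.2⟩
  have hM0 : 0 ≤ M := (hσ0 j hj ⟨0, hm⟩).le.trans (hσ j hj ⟨0, hm⟩).2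
  have hA := Evolving.one_le_sqrt_two_mul_log hm h0 h1
  refine Evolving.minimaxRisk_uncertaintySet_le_exactSet hΦ hM hcompact hμ (by positivity)
    fun i => ?_
  have h2 := Evolving.sqrt_fwdMSE_le (d := d) hn hσ hj i
  have h3 := hbound ω hω i
  set A := √(2 * Real.log (2 * m / δ))
  set r := √(Evolving.fwdMSE n σ d j i)
  have hr : 0 ≤ r := Real.sqrt_nonneg _
  calc _ ≤ κ * r * A + r := by gcongr
    -- `A ≥ 1` absorbs the confidence vector
    _ ≤ r * ((κ + 1) * A) := by nlinarith
    _ ≤ M / √(Evolving.effSize n σ d j) * ((κ + 1) * A) := by gcongr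
    _ = M * (κ + 1) * A / √(Evolving.effSize n σ d j) := by ring
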